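/- **Setting.** Let $n\ge 1$, let $v\in\mathbb R^n$ be a unit vector, $\tau\ge 0$, and $\mathbf T=\tau\, v^{\otimes 3}+\mathbf A$ where $\mathbf A\in\mathbb R^{n\times n\times n}$ has iid standard Gaussian entries. Let $T_i$ be the first-mode slices of $\mathbf T$, i.e. $(T_i)_{jk}=\mathbf T_{ijk}$, and let $$M=M(\mathbf T)=\operatorname{Tr}_{\mathbb R^n}\sum_i T_i\otimes T_i\in\mathbb R^{n\times n},$$ where $\operatorname{Tr}_{\mathbb R^n}$ is the partial trace, the linear map with $\operatorname{Tr}_{\mathbb R^n}(A\otimes B)=\operatorname{Tr}(A)\,B$. The partial-trace algorithm for tensor PCA outputs the top eigenvector of $M$. (The matrix $M$ need not be symmetric; a top eigenvector is a unit eigenvector for a positive eigenvalue $\lambda$ that is largest in modulus among all complex eigenvalues of $M$.) *Machine model.* A real RAM: a fixed program, independent of $n,\tau,v$ and of the accuracy, with unit-cost operations $+,-,\times,/,\sqrt{\ }$, comparisons and copies on real memory cells that are addressed indirectly through finitely many integer index registers, and copying, incrementing and comparing of index registers. One register initially holds $n$. The entries of the input tensor are read from a one-way stream in lexicographic order (so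 there is only one pass, and it is non-adaptive), and $n$ independent standard Gaussian numbers are available from a second one-way stream. **Theorem.** There are a program $P$, constants $K\in\mathbb N$ and $C>0$, and a function $\delta:\mathbb N\to\mathbb R$ with $\delta(n)\to 0$ as $n\to\infty$, such that the following hold. 1. (Linear time, sublinear space, one pass.) For every $n\ge 1$, every input tensor $\mathbf T\in\mathbb R^{n\times n\times n}$ and every content $g\in\mathbb R^n$ of the random stream, $P$ halts after at most $Kn^3$ steps and uses only the memory cells with addresses $0,\dots,Kn^2-1$. 2. (Spectral gap, power method and output.) For every $n\ge1$, every unit vector $v\in\mathbb R^n$, every $\varepsilon\in(0,1)$ and every $\tau\ge C\,n^{3/4}\sqrt{(\log n)/\varepsilon}$, with probability at least $1-\delta(n)$ over $\mathbf A$ and an independent standard Gaussian vector $g\in\mathbb R^n$, the matrix $M$ of $\mathbf T=\tau v^{\otimes3}+\mathbf A$ has a top eigenvector $u$ with eigenvalue $\lambda>0$ such that (a) every other eigenvalue $\mu\in\mathbb C$ of $M$ (counted with algebraic multiplicity) satisfies $2\min(1/\varepsilon,\sqrt n)\,|\mu|\le\lambda$; in particular $M$ has spectral gap ratio at least $2$,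 and at least $2/\varepsilon$ when $\varepsilon\ge n^{-1/2}$; (b) for every integer $t\ge K\log(n/\varepsilon)$, the unit vector $x_t$ obtained by $t$ iterations of the power method $x_0=g/\|g\|$, $x_{s+1}=Mx_s/\|Mx_s\|$ satisfies $\min(\|x_t-u\|,\|x_t+u\|)\le\varepsilon$; (c) the output $v'$ of $P$ on the input $\mathbf T$ with random stream $g$ is a unit vector with $\min(\|v'-u\|,\|v'+u\|)\le\varepsilon$. (Here "with probability at least $1-\delta(n)$" means that the set of all $(\mathbf A,g)$ for which this fails has outer measure at most $\delta(n)$.) -/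

import Mathlib

open MeasureTheory ProbabilityTheory Filter Topology
open scoped Kronecker

/-! ## A streaming real RAM

Finitely many index registers (natural numbers) and a memory of real cells addressed indirectly
through the index registers. The input is a one-way stream: each `read` consumes the next entry, and
an entry that has gone by cannot be read again, so every run makes at most one pass, in a fixed order.
Random numbers come from a second one-way stream. Every instruction costs one time unit. -/

namespace RealRAM

/-- Arithmetic on real cells. -/
inductive Op where
  | add
  | sub
  | mul
  | div

/-- Value of an arithmetic operation (division by `0` gives `0`). -/
noncomputable def Op.eval : Op → ℝ → ℝ → ℝ
  | .add, x, y => x + y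
  | .sub, x, y => x - y
  | .mul, x, y => x * y
  | .div, x, y => x / y

/-- Instructions. Write `r a` for index register `a` and `m[p]` for memory cell `p`. Index registers
can only be set to a constant, copied, incremented and compared, so that after `t` steps all their
values are at most `n + t` plus a constant of the program. -/
inductive Instr where
  /-- `r a := k` -/
  | setIdx (a k : ℕ)
  /-- `r a := r b` -/
  | copyIdx (a b : ℕ)
  /-- `r a := r a + 1` -/
  | incIdx (a : ℕ)
  /-- go to instruction `l` -/
  | jump (l : ℕ)
  /-- if `r a < r b` go to instruction `l` -/
  | jumpLt (a b l : ℕ)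
  /-- `m[r a] := q` -/
  | const (a : ℕ) (q : ℚ)
  /-- `m[r a] := m[r b]` -/
  | move (a b : ℕ)
  /-- `m[r a] := m[r b] o m[r c]` -/
  | arith (o : Op) (a b c : ℕ)
  /-- `m[r a] := √ m[r b]` -/
  | sqrt (a b : ℕ)
  /-- if `m[r a] ≤ m[r b]` go to instruction `l` -/
  | jumpLe (a b l : ℕ)
  /-- `m[r a] :=` next entry of the input stream (`0` once the stream is exhausted) -/
  | read (a : ℕ)
  /-- `m[r a] :=` next entry of the random stream (`0` once the stream is exhausted) -/
  | rand (a : ℕ)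

/-- A program is a fixed finite list of instructions. -/
abbrev Program := List Instr

/-- Machine configurations; `input` and `coins` are the unread parts of the two streams. -/
structure Config where
  pc : ℕ
  idx : ℕ → ℕ
  mem : ℕ → ℝ
  input : List ℝ
  coins : List ℝ

/-- Write `x` into the cell that register `a` points to, and go to the next instruction. -/
def Config.write (c : Config) (a : ℕ) (x : ℝ) : Config :=
  { c with pc := c.pc + 1, mem := Function.update c.mem (c.idx a) x }

/-- Set index register `a` to `k`, and go to the next instruction. -/
def Config.setReg (c : Config) (a k : ℕ) : Config :=
  { c with pc := c.pc + 1, idx := Function.update c.idx a k }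

open Classical in
/-- Effect of one instruction. -/
noncomputable def Instr.exec : Instr → Config → Config
  | .setIdx a k, c => c.setReg a k
  | .copyIdx a b, c => c.setReg a (c.idx b)
  | .incIdx a, c => c.setReg a (c.idx a + 1)
  | .jump l, c => { c with pc := l }
  | .jumpLt a b l, c => { c with pc := if c.idx a < c.idx b then l else c.pc + 1 }
  | .const a q, c => c.write a (q : ℝ)
  | .move a b, c => c.write a (c.mem (c.idx b))
  | .arith o a b d, c => c.write a (o.eval (c.mem (c.idx b)) (c.mem (c.idx d)))
  | .sqrt a b, c => c.write a (Real.sqrt (c.mem (c.idx b)))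
  | .jumpLe a b l, c =>
      { c with pc := if c.mem (c.idx a) ≤ c.mem (c.idx b) then l else c.pc + 1 }
  | .read a, c => { c.write a (c.input.headD 0) with input := c.input.tail }
  | .rand a, c => { c.write a (c.coins.headD 0) with coins := c.coins.tail }

/-- Addresses of the memory cells that an instruction reads or writes. -/
def Instr.addresses : Instr → Config → List ℕ
  | .setIdx _ _, _ => []
  | .copyIdx _ _, _ => []
  | .incIdx _, _ => []
  | .jump _, _ => []
  | .jumpLt _ _ _, _ => []
  | .const a _, c => [c.idx a]
  | .move a b, c => [c.idx a, c.idx b]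
  | .arith _ a b d, c => [c.idx a, c.idx b, c.idx d]
  | .sqrt a b, c => [c.idx a, c.idx b]
  | .jumpLe a b _, c => [c.idx a, c.idx b]
  | .read a, c => [c.idx a]
  | .rand a, c => [c.idx a]

/-- One step; the machine stands still once the program counter has left the program. -/
noncomputable def Program.step (P : Program) (c : Config) : Config :=
  match P[c.pc]? with
  | some i => i.exec c
  | none => c

/-- Memory addresses used by the next step from configuration `c`. -/
def Program.addresses (P : Program) (c : Config) : List ℕ :=
  match P[c.pc]? with
  | some i => i.addresses c
  | none => []

/-- Start: register `0` holds the size `n`, everything else is zero. -/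
def initial (n : ℕ) (input coins : List ℝ) : Config where
  pc := 0
  idx := fun a => if a = 0 then n else 0
  mem := fun _ => 0
  input := input
  coins := coins

/-- The configuration after `t` steps. -/
noncomputable def Program.run (P : Program) (n : ℕ) (input coins : List ℝ) (t : ℕ) : Config :=
  P.step^[t] (initial n input coins)

/-- The run halts after at most `time` steps and only ever uses the memory cells `0, …, space - 1`. -/
def Program.RunsWithin (P : Program) (n : ℕ) (input coins : List ℝ) (time space : ℕ) : Prop :=
  P.length ≤ (P.run n input coins time).pc ∧
    ∀ t < time, ∀ p ∈ P.addresses (P.run n input coins t), p < space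

/-- The vector in the cells `0, …, n - 1` after `time` steps; this is the output of the
program if it has halted by then. -/
noncomputable def Program.output (P : Program) (n : ℕ) (input coins : List ℝ) (time : ℕ) :
    EuclideanSpace ℝ (Fin n) :=
  WithLp.toLp 2 fun i => (P.run n input coins time).mem i

end RealRAM

/-! ## The spiked tensor model and the partial trace matrix -/

namespace TensorPCA

/-- Order-3 tensors of size `n × n × n`. -/
abbrev Tensor (n : ℕ) := Fin n × Fin n × Fin n → ℝ

/-- The spiked tensor `τ • v ⊗ v ⊗ v + A`. -/
def spiked {n : ℕ} (τ : ℝ) (v : EuclideanSpace ℝ (Fin n)) (A : Tensor n) : Tensor n :=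
  fun p => τ * (v p.1 * v p.2.1 * v p.2.2) + A p

/-- Law of a family of independent standard Gaussians indexed by `ι`. -/
noncomputable def stdGaussianPi (ι : Type) [Fintype ι] : Measure (ι → ℝ) :=
  Measure.pi fun _ => gaussianReal 0 1

/-- Entries of the tensor in lexicographic order, that is, slice after slice. -/
def stream {n : ℕ} (T : Tensor n) : List ℝ :=
  (List.finRange n).flatMap fun i => (List.finRange n).flatMap fun j =>
    (List.finRange n).map fun k => T (i, j, k)

/-- First-mode slice `T_i`. -/
def slice {n : ℕ} (T : Tensor n) (i : Fin n) : Matrix (Fin n) (Fin n) ℝ :=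
  Matrix.of fun j k => T (i, j, k)

/-- Partial trace over the first tensor factor of `ℝⁿ ⊗ ℝⁿ`. -/
def partialTrace {n : ℕ} (X : Matrix (Fin n × Fin n) (Fin n × Fin n) ℝ) :
    Matrix (Fin n) (Fin n) ℝ :=
  Matrix.of fun j k => ∑ a, X (a, j) (a, k)

theorem partialTrace_kronecker {n : ℕ} (A B : Matrix (Fin n) (Fin n) ℝ) :
    partialTrace (A ⊗ₖ B) = A.trace • B := by
  ext j k
  simp [partialTrace, Matrix.trace, Finset.sum_mul]

/-- The matrix `M = Tr_{ℝⁿ} ∑ᵢ Tᵢ ⊗ Tᵢ`. -/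
def traceMatrix {n : ℕ} (T : Tensor n) : Matrix (Fin n) (Fin n) ℝ :=
  partialTrace (∑ i, slice T i ⊗ₖ slice T i)

/-- The complex eigenvalues of a real square matrix, with algebraic multiplicity. -/
noncomputable def eigenvalues {n : ℕ} (M : Matrix (Fin n) (Fin n) ℝ) : Multiset ℂ :=
  (M.map (algebraMap ℝ ℂ)).charpoly.roots

/-- `u` is a unit eigenvector of `M` whose eigenvalue `lam` is positive and largest in modulus. -/
def IsTopEigenvector {n : ℕ} (M : Matrix (Fin n) (Fin n) ℝ) (lam : ℝ)
    (u : EuclideanSpace ℝ (Fin n)) : Prop :=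
  ‖u‖ = 1 ∧ M.toEuclideanLin u = lam • u ∧ 0 < lam ∧ ∀ z ∈ eigenvalues M, ‖z‖ ≤ lam

/-- All eigenvalues other than one copy of `lam` (counted with multiplicity) are smaller
in modulus than `lam` by a factor of at least `r`. For `r > 1` and `lam > 0` this makes `lam` simple. -/
def SpectralGapRatioGE {n : ℕ} (M : Matrix (Fin n) (Fin n) ℝ) (lam r : ℝ) : Prop :=
  (lam : ℂ) ∈ eigenvalues M ∧ ∀ z ∈ (eigenvalues M).erase (lam : ℂ), r * ‖z‖ ≤ lam

/-- The power method: normalize, then `t` times apply `M` and normalize. -/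
noncomputable def powerIterate {n : ℕ} (M : Matrix (Fin n) (Fin n) ℝ)
    (x : EuclideanSpace ℝ (Fin n)) : ℕ → EuclideanSpace ℝ (Fin n)
  | 0 => ‖x‖⁻¹ • x
  | t + 1 => ‖M.toEuclideanLin (powerIterate M x t)‖⁻¹ • M.toEuclideanLin (powerIterate M x t)

/-- Distance up to sign. -/
noncomputable def signDist {n : ℕ} (x u : EuclideanSpace ℝ (Fin n)) : ℝ :=
  min ‖x - u‖ ‖x + u‖

end TensorPCA

/-! Write `h` for the vector of slice traces. The partial trace of `T_i ⊗ T_i` is `Tr(T_i) T_i`, so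
`⟨y, M x⟩ = T(h, y, x)`, where `h = τ v + h_A` and `h_A` collects the traces of the noise. Hence `M
= β v vᵀ + N` with `β = τ² + τ ⟨v, h_A⟩` and `⟨y, N x⟩ = A(h, y, x)` (`exists_traceMap_spiked`). As
`h` depends on `A`, the noise `N` is bounded through the injective norm of `A`, which a net argument
shows to be `O(√(n log n))`. Second moments give `‖h_A‖ ≤ n √(log n)` and `|⟨v, h_A⟩| ≤ n^(3/4)`
with high probability. For `τ` above the threshold this yields `‖N‖ ≤ η β` with `η` of order `√ε
n^(-1/4) + ε` (`noise_le_signal`).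

Such an `M`, although not symmetric, has a right eigenvector `u` and a left eigenvector `l` close to
`v`, for the same eigenvalue `lam`. The hyperplane orthogonal to `l` is invariant, and `M` has norm
at most `6 η lam` on it (`exists_dominant`). This gives the spectral gap and the geometric
convergence of the power method.

The power method also needs a start `g` that is not nearly orthogonal to `l`. In place of `l`, the
proof uses `q = (Mᵀ)ⁿ v`, which is polynomial in `A`, independent of `g` and almost parallel to `l`.
Anticoncentration bounds `|⟨q, g⟩|` from below, and `Dominant.le_abs_coeff` transfers this to `l`.

The program accumulates `M` slice by slice and computes the normalized vector `Mⁿ g` exactly. The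
`n` products cost `O(n³)` steps, like reading the input. They suffice for every `ε` without knowing
it, because `6 η ≤ √ε / 4`. -/

namespace RealRAM

/-! ### A calculus of time and space bounds for program runs -/

/-- From `c`, the program reaches within `T` steps a configuration satisfying `Q`, using only cells
with addresses below `S` on the way. -/
def Program.Reaches (P : Program) (S : ℕ) (c : Config) (T : ℕ) (Q : Config → Prop) : Prop :=
  ∃ k ≤ T, Q (P.step^[k] c) ∧ ∀ t < k, ∀ p ∈ P.addresses (P.step^[t] c), p < S

variable {P : Program} {S : ℕ}

theorem Program.Reaches.done {c : Config} {T : ℕ} {Q : Config → Prop} (h : Q c) :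
    P.Reaches S c T Q :=
  ⟨0, Nat.zero_le _, h, by simp⟩

theorem Program.Reaches.step {c : Config} {T : ℕ} {Q : Config → Prop} (i : Instr)
    (hi : P[c.pc]? = some i) (ha : ∀ p ∈ i.addresses c, p < S)
    (h : P.Reaches S (i.exec c) T Q) : P.Reaches S c (T + 1) Q := by
  obtain ⟨k, hk, hQ, hadr⟩ := h
  have hs : P.step c = i.exec c := by simp [Program.step, hi]
  refine ⟨k + 1, by omega, by rwa [Function.iterate_succ_apply, hs], fun t ht p hp => ?_⟩
  cases t with
  | zero => exact ha p (by simpa [Program.addresses, hi] using hp)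
  | succ t =>
    rw [Function.iterate_succ_apply, hs] at hp
    exact hadr t (by omega) p hp

theorem Program.Reaches.trans {c : Config} {T₁ T₂ : ℕ} {R Q : Config → Prop}
    (h₁ : P.Reaches S c T₁ R) (h₂ : ∀ c', R c' → P.Reaches S c' T₂ Q) :
    P.Reaches S c (T₁ + T₂) Q := by
  obtain ⟨k, hk, hR, hadr⟩ := h₁
  obtain ⟨l, hl, hQ, hadr'⟩ := h₂ _ hR
  refine ⟨k + l, by omega, by rwa [add_comm, Function.iterate_add_apply], fun t ht p hp => ?_⟩
  by_cases htk : t < k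
  · exact hadr t htk p hp
  · obtain ⟨s, rfl⟩ := Nat.exists_eq_add_of_le (not_lt.mp htk)
    rw [add_comm, Function.iterate_add_apply] at hp
    exact hadr' s (by omega) p hp

theorem Program.Reaches.mono {c : Config} {T₁ T₂ : ℕ} {R Q : Config → Prop}
    (h₁ : P.Reaches S c T₁ R) (hT : T₁ ≤ T₂) (h : ∀ c', R c' → Q c') : P.Reaches S c T₂ Q := by
  obtain ⟨k, hk, hR, hadr⟩ := h₁
  exact ⟨k, hk.trans hT, h _ hR, hadr⟩

/-- In the applications the invariant `I i` carries the program counter, equal to the loop head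
while `i < N` and to the exit at `i = N`. This fits loops that test at the bottom. -/
theorem Program.Reaches.loop {N T : ℕ} (I : ℕ → Config → Prop) {c : Config} (h0 : I 0 c)
    (h : ∀ i < N, ∀ c, I i c → P.Reaches S c T (I (i + 1))) : P.Reaches S c (N * T) (I N) := by
  induction N with
  | zero => exact .done h0
  | succ N ih =>
    rw [Nat.succ_mul]
    exact (ih fun i hi => h i (by omega)).trans (h N (by omega))

/-! ### The program and its verification loop by loop -/

/-- Read the tensor slice after slice while accumulating the partial trace matrix, then apply this
matrix `n` times to the random vector and normalize. The cells `0, …, n - 1` hold the vector,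
`n` and `n + 1` are scratch cells, the matrix starts at `n + 2` and the buffer at `n + 2 + n ^ 2`. -/
def tracePower : Program := [
  .copyIdx 2 0, .copyIdx 3 2, .incIdx 3, .copyIdx 4 3, .incIdx 4, .copyIdx 5 4, .setIdx 6 0,
  .setIdx 7 0, .incIdx 5, .incIdx 7, .jumpLt 7 0 8, .incIdx 6, .jumpLt 6 0 7, .setIdx 6 0,
  .const 2 0, .copyIdx 10 5, .setIdx 7 0, .setIdx 8 0,
  .read 10, .jumpLt 7 8 22, .jumpLt 8 7 22, .arith .add 2 2 10, .incIdx 10, .incIdx 8,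
  .jumpLt 8 0 18, .incIdx 7, .jumpLt 7 0 17, .copyIdx 9 4, .copyIdx 10 5,
  .arith .mul 10 2 10, .arith .add 9 9 10, .incIdx 10, .incIdx 9, .jumpLt 9 5 29,
  .incIdx 6, .jumpLt 6 0 14, .setIdx 6 0,
  .rand 6, .incIdx 6, .jumpLt 6 0 37, .setIdx 6 0,
  .copyIdx 9 4, .copyIdx 10 5, .setIdx 7 0, .const 10 0, .setIdx 8 0,
  .arith .mul 3 9 8, .arith .add 10 10 3, .incIdx 9, .incIdx 8, .jumpLt 8 0 46,
  .incIdx 10, .incIdx 7, .jumpLt 7 0 44, .setIdx 7 0, .copyIdx 10 5,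
  .move 7 10, .incIdx 10, .incIdx 7, .jumpLt 7 0 56, .incIdx 6, .jumpLt 6 0 41,
  .const 2 0, .setIdx 7 0, .arith .mul 3 7 7, .arith .add 2 2 3, .incIdx 7, .jumpLt 7 0 64,
  .sqrt 2 2, .setIdx 7 0, .arith .div 7 7 2, .incIdx 7, .jumpLt 7 0 70]

/-- The cells `b, …, b + m - 1` hold `f 0, …, f (m - 1)`. -/
def Holds (mem : ℕ → ℝ) (b m : ℕ) (f : ℕ → ℝ) : Prop := ∀ p < m, mem (b + p) = f p

theorem Holds.update {mem : ℕ → ℝ} {b m : ℕ} {f : ℕ → ℝ} (h : Holds mem b m f) {a : ℕ} {x : ℝ}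
    (ha : a < b ∨ b + m ≤ a) : Holds (Function.update mem a x) b m f := fun p hp => by
  rw [Function.update_of_ne (by omega), h p hp]

theorem Holds.snoc {mem : ℕ → ℝ} {b m : ℕ} {f : ℕ → ℝ} (h : Holds mem b m f) {a : ℕ} {x : ℝ}
    (ha : a = b + m) (hx : x = f m) : Holds (Function.update mem a x) b (m + 1) f := fun p hp => by
  obtain hp | rfl := Nat.lt_succ_iff_lt_or_eq.mp hp
  · rw [Function.update_of_ne (by omega), h p hp]
  · rw [← ha, Function.update_self, hx]

theorem Holds.mono {mem : ℕ → ℝ} {b m : ℕ} {f g : ℕ → ℝ} (h : Holds mem b m f) {l : ℕ} (hl : l ≤ m)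
    (hg : ∀ p < l, f p = g p) : Holds mem b l g := fun p hp => by
  rw [h p (by omega), hg p hp]

theorem flat_lt {n j k : ℕ} (hj : j < n) (hk : k < n) : j * n + k < n * n := by
  calc j * n + k < j * n + n := by omega
    _ = (j + 1) * n := by ring
    _ ≤ n * n := Nat.mul_le_mul_right _ hj

/-- The base addresses of the memory layout of `tracePower` are in place. -/
def Layout (n : ℕ) (idx : ℕ → ℕ) : Prop :=
  idx 0 = n ∧ idx 2 = n ∧ idx 3 = n + 1 ∧ idx 4 = n + 2 ∧ idx 5 = n + 2 + n * n

/-- Registers 6 to 10 are the working registers: outer counter, row, column, matrix pointer and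
buffer pointer. Counters double as pointers into the vector, which starts at cell 0. -/
theorem Layout.update {n : ℕ} {idx : ℕ → ℕ} (h : Layout n idx) {a k : ℕ} (ha : 5 < a) :
    Layout n (Function.update idx a k) := by
  obtain ⟨h0, h2, h3, h4, h5⟩ := h
  refine ⟨?_, ?_, ?_, ?_, ?_⟩ <;> rw [Function.update_of_ne (by omega)] <;> assumption
-- Index registers cannot be added, so the buffer address `n + 2 + n * n` is reached by `n` rounds
-- of `n` increments. All loops test at the bottom, hence `0 < n`.
theorem setup_inner {n S a i : ℕ} (hn : 0 < n) {inp coi : List ℝ} (c : Config)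
    (h : c.pc = 7 ∧ c.idx 0 = n ∧ c.idx 2 = n ∧ c.idx 3 = n + 1 ∧ c.idx 4 = n + 2 ∧ c.idx 5 = a ∧
      c.idx 6 = i ∧ c.mem = (fun _ => 0) ∧ c.input = inp ∧ c.coins = coi) :
    tracePower.Reaches S c (1 + n * 3 + 2) fun c => c.pc = (if i + 1 < n then 7 else 13) ∧ c.idx 0 = n ∧
      c.idx 2 = n ∧ c.idx 3 = n + 1 ∧ c.idx 4 = n + 2 ∧ c.idx 5 = a + n ∧ c.idx 6 = i + 1 ∧
      c.mem = (fun _ => 0) ∧ c.input = inp ∧ c.coins = coi := by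
  obtain ⟨pc, idx, mem, inp', coi'⟩ := c
  simp only at h
  obtain ⟨rfl, h0, h2, h3, h4, h5, h6, hm, rfl, rfl⟩ := h
  refine Program.Reaches.trans (T₁ := 1 + n * 3) (R := fun c => c.pc = 11 ∧ c.idx 0 = n ∧
      c.idx 2 = n ∧ c.idx 3 = n + 1 ∧ c.idx 4 = n + 2 ∧ c.idx 5 = a + n ∧ c.idx 6 = i ∧
      c.mem = (fun _ => 0) ∧ c.input = inp' ∧ c.coins = coi') ?_ ?_
  -- With the constant summand last, each `step` takes one unit off the time budget.
  · rw [add_comm]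
    refine .step _ rfl (by simp [Instr.addresses]) ?_
    refine (Program.Reaches.loop (N := n) (fun j c => c.pc = (if j < n then 8 else 11) ∧ c.idx 0 = n ∧
      c.idx 2 = n ∧ c.idx 3 = n + 1 ∧ c.idx 4 = n + 2 ∧ c.idx 5 = a + j ∧ c.idx 6 = i ∧ c.idx 7 = j ∧
      c.mem = (fun _ => 0) ∧ c.input = inp' ∧ c.coins = coi') ?_ ?_).mono le_rfl ?_
    · simp [Instr.exec, Config.setReg, *]
    · rintro j hj ⟨pc, idx, mem, inp, coi⟩ h
      simp only [hj, if_true] at h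
      obtain ⟨rfl, h0, h2, h3, h4, h5, h6, h7, hm, rfl, rfl⟩ := h
      refine .step _ rfl (by simp [Instr.addresses]) ?_
      refine .step _ rfl (by simp [Instr.addresses]) ?_
      refine .step _ rfl (by simp [Instr.addresses]) (.done ?_)
      simp [Instr.exec, Config.setReg, *]
      omega
    · simp +contextual
  · rintro ⟨pc, idx, mem, inp, coi⟩ h
    simp only at h
    obtain ⟨rfl, h0, h2, h3, h4, h5, h6, hm, rfl, rfl⟩ := h
    refine .step _ rfl (by simp [Instr.addresses]) ?_
    refine .step _ rfl (by simp [Instr.addresses]) (.done ?_)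
    simp [Instr.exec, Config.setReg, *]

theorem setup {n S : ℕ} (hn : 0 < n) (inp coi : List ℝ) :
    tracePower.Reaches S (initial n inp coi) (7 + n * (1 + n * 3 + 2) + 1) fun c => c.pc = 14 ∧
      Layout n c.idx ∧ c.idx 6 = 0 ∧ c.mem = (fun _ => 0) ∧ c.input = inp ∧ c.coins = coi := by
  refine Program.Reaches.trans (T₁ := 7 + n * (1 + n * 3 + 2)) (R := fun c => c.pc = 13 ∧
    c.idx 0 = n ∧ c.idx 2 = n ∧ c.idx 3 = n + 1 ∧ c.idx 4 = n + 2 ∧ c.idx 5 = n + 2 + n * n ∧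
    c.mem = (fun _ => 0) ∧ c.input = inp ∧ c.coins = coi) ?_ ?_
  · rw [add_comm]
    refine .step _ rfl (by simp [Instr.addresses]) ?_
    refine .step _ rfl (by simp [Instr.addresses]) ?_
    refine .step _ rfl (by simp [Instr.addresses]) ?_
    refine .step _ rfl (by simp [Instr.addresses]) ?_
    refine .step _ rfl (by simp [Instr.addresses]) ?_
    refine .step _ rfl (by simp [Instr.addresses]) ?_
    refine .step _ rfl (by simp [Instr.addresses]) ?_
    refine (Program.Reaches.loop (N := n) (fun i c => c.pc = (if i < n then 7 else 13) ∧
      c.idx 0 = n ∧ c.idx 2 = n ∧ c.idx 3 = n + 1 ∧ c.idx 4 = n + 2 ∧ c.idx 5 = n + 2 + i * n ∧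
      c.idx 6 = i ∧ c.mem = (fun _ => 0) ∧ c.input = inp ∧ c.coins = coi) ?_ ?_).mono le_rfl ?_
    · simp [Instr.exec, Config.setReg, initial, *]
    · intro i hi c h
      simp only [hi, if_true] at h
      refine (setup_inner hn c h).mono le_rfl fun c' h' => ?_
      rwa [show n + 2 + (i + 1) * n = n + 2 + i * n + n by ring]
    · simp +contextual
  · rintro ⟨pc, idx, mem, inp, coi⟩ h
    simp only at h
    obtain ⟨rfl, h0, h2, h3, h4, h5, hm, rfl, rfl⟩ := h
    refine .step _ rfl (by simp [Instr.addresses]) (.done ?_)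
    simp [Instr.exec, Config.setReg, Layout, *]

/-- One round of the loop that reads row `j` of a slice with entries `f`. -/
theorem read_entry {n S j k q : ℕ} (hS : n + 2 + n * n + n * n ≤ S) (hj : j < n) (hk : k < n)
    {i : ℕ} {A f : ℕ → ℝ} {inp coi : List ℝ} (hf : f (j * n + k) = inp.getD (q + (j * n + k)) 0)
    (c : Config) (h : c.pc = 18 ∧ Layout n c.idx ∧ c.idx 6 = i ∧ c.idx 7 = j ∧ c.idx 8 = k ∧
      c.idx 10 = n + 2 + n * n + (j * n + k) ∧ Holds c.mem (n + 2) (n * n) A ∧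
      Holds c.mem (n + 2 + n * n) (j * n + k) f ∧
      c.mem n = ∑ l ∈ Finset.range j, f (l * n + l) + (if j < k then f (j * n + j) else 0) ∧
      c.input = inp.drop (q + (j * n + k)) ∧ c.coins = coi) :
    tracePower.Reaches S c 7 fun c => c.pc = (if k + 1 < n then 18 else 25) ∧ Layout n c.idx ∧
      c.idx 6 = i ∧ c.idx 7 = j ∧ c.idx 8 = k + 1 ∧
      c.idx 10 = n + 2 + n * n + (j * n + (k + 1)) ∧ Holds c.mem (n + 2) (n * n) A ∧
      Holds c.mem (n + 2 + n * n) (j * n + (k + 1)) f ∧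
      c.mem n = ∑ l ∈ Finset.range j, f (l * n + l) + (if j < k + 1 then f (j * n + j) else 0) ∧
      c.input = inp.drop (q + (j * n + (k + 1))) ∧ c.coins = coi := by
  obtain ⟨pc, idx, mem, inp', coi'⟩ := c
  simp only at h
  obtain ⟨rfl, hL, h6, h7, h8, h10, hA, hB, ht, rfl, rfl⟩ := h
  have hlt := flat_lt hj hk
  have hL' := hL
  obtain ⟨h0, h2, h3, h4, h5⟩ := hL'
  have hx : (inp.drop (q + (j * n + k))).headD 0 = f (j * n + k) := by
    rw [hf, List.headD_eq_head?_getD, List.head?_drop, List.getD_eq_getElem?_getD]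
  have htl : (inp.drop (q + (j * n + k))).tail = inp.drop (q + (j * n + (k + 1))) := by
    rw [List.tail_drop]; rfl
  obtain ⟨x, hxf⟩ : ∃ x, x = f (j * n + k) := ⟨_, rfl⟩
  rw [← hxf] at hx
  have hA' := hA.update (a := n + 2 + n * n + (j * n + k)) (x := x) (by omega)
  have hB' := hB.snoc (a := n + 2 + n * n + (j * n + k)) (x := x) rfl hxf
  refine .step _ rfl (by simp [Instr.addresses, h10]; omega) ?_
  simp only [Instr.exec, Config.write, h10, hx, htl]
  -- The program tests `j = k` by two strict comparisons. Only a diagonal entry passes both and is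
  -- added to the trace in cell `n`; that longest path has 7 instructions.
  rcases lt_trichotomy j k with hjk | hjk | hjk
  · refine .step _ rfl (by simp [Instr.addresses]) ?_
    simp only [Instr.exec, h7, h8, hjk, if_true]
    refine .step _ rfl (by simp [Instr.addresses]) ?_
    refine .step _ rfl (by simp [Instr.addresses]) ?_
    refine .step _ rfl (by simp [Instr.addresses]) (.done ?_)
    simp [Instr.exec, Config.setReg, h0, h6, h7, h8, h10, hL, Layout.update]
    rw [Function.update_of_ne (by omega), ht]
    exact ⟨by omega, hA', hB', by simp [hjk, hjk.le]⟩
  · refine .step _ rfl (by simp [Instr.addresses]) ?_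
    simp only [Instr.exec, h7, h8, hjk, lt_irrefl, if_false]
    refine .step _ rfl (by simp [Instr.addresses]) ?_
    simp only [Instr.exec, h7, h8, hjk, lt_irrefl, if_false]
    refine .step _ rfl (by simp [Instr.addresses, h10, h2]; omega) ?_
    simp only [Instr.exec, Config.write, h2, h10]
    refine .step _ rfl (by simp [Instr.addresses]) ?_
    refine .step _ rfl (by simp [Instr.addresses]) ?_
    refine .step _ rfl (by simp [Instr.addresses]) (.done ?_)
    subst hjk
    simp [Instr.exec, Config.setReg, h0, h6, h7, h8, h10, Layout.update, hL]
    refine ⟨by omega, hA'.update (by omega), Holds.update hB' (by omega), ?_⟩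
    simp only [Op.eval]
    rw [Function.update_of_ne (by omega), ht, hxf]
    simp
  · refine .step _ rfl (by simp [Instr.addresses]) ?_
    simp only [Instr.exec, h7, h8, hjk.not_gt, if_false]
    refine .step _ rfl (by simp [Instr.addresses]) ?_
    simp only [Instr.exec, h7, h8, hjk, if_true]
    refine .step _ rfl (by simp [Instr.addresses]) ?_
    refine .step _ rfl (by simp [Instr.addresses]) ?_
    refine .step _ rfl (by simp [Instr.addresses]) (.done ?_)
    simp [Instr.exec, Config.setReg, h0, h6, h7, h8, h10, hL, Layout.update]
    rw [Function.update_of_ne (by omega), ht]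
    exact ⟨by omega, hA', hB', by simp [hjk.not_gt, show ¬ (j ≤ k) by omega]⟩

theorem read_row {n S j q : ℕ} (hS : n + 2 + n * n + n * n ≤ S) (hj : j < n)
    {i : ℕ} {A f : ℕ → ℝ} {inp coi : List ℝ} (hf : ∀ p < n * n, f p = inp.getD (q + p) 0)
    (c : Config) (h : c.pc = 17 ∧ Layout n c.idx ∧ c.idx 6 = i ∧ c.idx 7 = j ∧
      c.idx 10 = n + 2 + n * n + j * n ∧ Holds c.mem (n + 2) (n * n) A ∧
      Holds c.mem (n + 2 + n * n) (j * n) f ∧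
      c.mem n = ∑ l ∈ Finset.range j, f (l * n + l) ∧
      c.input = inp.drop (q + j * n) ∧ c.coins = coi) :
    tracePower.Reaches S c (1 + n * 7 + 2) fun c => c.pc = (if j + 1 < n then 17 else 27) ∧
      Layout n c.idx ∧ c.idx 6 = i ∧ c.idx 7 = j + 1 ∧
      c.idx 10 = n + 2 + n * n + (j + 1) * n ∧ Holds c.mem (n + 2) (n * n) A ∧
      Holds c.mem (n + 2 + n * n) ((j + 1) * n) f ∧
      c.mem n = ∑ l ∈ Finset.range (j + 1), f (l * n + l) ∧
      c.input = inp.drop (q + (j + 1) * n) ∧ c.coins = coi := by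
  obtain ⟨pc, idx, mem, inp', coi'⟩ := c
  simp only at h
  obtain ⟨rfl, hL, h6, h7, h10, hA, hB, ht, rfl, rfl⟩ := h
  have hs : (j + 1) * n = j * n + n := by ring
  refine Program.Reaches.trans (T₁ := 1 + n * 7) (R := fun c => c.pc = 25 ∧ Layout n c.idx ∧
    c.idx 6 = i ∧ c.idx 7 = j ∧ c.idx 10 = n + 2 + n * n + (j + 1) * n ∧
    Holds c.mem (n + 2) (n * n) A ∧ Holds c.mem (n + 2 + n * n) ((j + 1) * n) f ∧
    c.mem n = ∑ l ∈ Finset.range (j + 1), f (l * n + l) ∧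
    c.input = inp.drop (q + (j + 1) * n) ∧ c.coins = coi') ?_ ?_
  · rw [add_comm 1 (n * 7)]
    refine .step _ rfl (by simp [Instr.addresses]) ?_
    refine (Program.Reaches.loop (N := n) (fun k c => c.pc = (if k < n then 18 else 25) ∧
      Layout n c.idx ∧ c.idx 6 = i ∧ c.idx 7 = j ∧ c.idx 8 = k ∧
      c.idx 10 = n + 2 + n * n + (j * n + k) ∧ Holds c.mem (n + 2) (n * n) A ∧
      Holds c.mem (n + 2 + n * n) (j * n + k) f ∧
      c.mem n = ∑ l ∈ Finset.range j, f (l * n + l) + (if j < k then f (j * n + j) else 0) ∧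
      c.input = inp.drop (q + (j * n + k)) ∧ c.coins = coi') ?_ ?_).mono le_rfl ?_
    · simp [Instr.exec, Config.setReg, *, Layout.update, show 0 < n by omega]
    · intro k hk c h
      simp only [hk, if_true] at h
      exact read_entry hS hj hk (hf _ (flat_lt hj hk)) c h
    · rintro c ⟨h1, h2, h3, h4, -, h5, h6, h7, h8, h9, h10⟩
      rw [hs, Finset.sum_range_succ]
      simp only [lt_irrefl, if_false, hj, if_true] at h1 h8
      exact ⟨h1, h2, h3, h4, h5, h6, h7, h8, h9, h10⟩
  · rintro ⟨pc, idx, mem, inp, coi⟩ h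
    simp only at h
    obtain ⟨rfl, hL, h6, h7, h10, hA, hB, ht, rfl, rfl⟩ := h
    refine .step _ rfl (by simp [Instr.addresses]) ?_
    refine .step _ rfl (by simp [Instr.addresses]) (.done ?_)
    rw [hs] at hB ⊢
    simp [Instr.exec, Config.setReg, *, Layout.update, hL.1]

/-- The trace of a slice multiplies all of its entries but is known only after the last diagonal
entry has been read, so the slice is buffered. One buffer of `n * n` cells serves all slices. -/
theorem read_slice {n S q : ℕ} (hn : 0 < n) (hS : n + 2 + n * n + n * n ≤ S)
    {i : ℕ} {A f : ℕ → ℝ} {inp coi : List ℝ} (hf : ∀ p < n * n, f p = inp.getD (q + p) 0)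
    (c : Config) (h : c.pc = 14 ∧ Layout n c.idx ∧ c.idx 6 = i ∧ Holds c.mem (n + 2) (n * n) A ∧
      c.input = inp.drop q ∧ c.coins = coi) :
    tracePower.Reaches S c (3 + n * (1 + n * 7 + 2)) fun c => c.pc = 27 ∧
      Layout n c.idx ∧ c.idx 6 = i ∧ Holds c.mem (n + 2) (n * n) A ∧
      Holds c.mem (n + 2 + n * n) (n * n) f ∧ c.mem n = ∑ l ∈ Finset.range n, f (l * n + l) ∧
      c.input = inp.drop (q + n * n) ∧ c.coins = coi := by
  obtain ⟨pc, idx, mem, inp', coi'⟩ := c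
  simp only at h
  obtain ⟨rfl, hL, h6, hA, rfl, rfl⟩ := h
  have hL' := hL
  obtain ⟨h0, h2, h3, h4, h5⟩ := hL'
  rw [add_comm]
  refine .step _ rfl (by simp [Instr.addresses, h2]; omega) ?_
  refine .step _ rfl (by simp [Instr.addresses]) ?_
  refine .step _ rfl (by simp [Instr.addresses]) ?_
  refine (Program.Reaches.loop (N := n) (fun j c => c.pc = (if j < n then 17 else 27) ∧
      Layout n c.idx ∧ c.idx 6 = i ∧ c.idx 7 = j ∧
      c.idx 10 = n + 2 + n * n + j * n ∧ Holds c.mem (n + 2) (n * n) A ∧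
      Holds c.mem (n + 2 + n * n) (j * n) f ∧
      c.mem n = ∑ l ∈ Finset.range j, f (l * n + l) ∧
      c.input = inp.drop (q + j * n) ∧ c.coins = coi') ?_ ?_).mono le_rfl ?_
  · simp [Instr.exec, Config.setReg, Config.write, *, Layout.update]
    exact ⟨hA.update (by omega), fun p hp => by omega⟩
  · intro j hj c h
    simp only [hj, if_true] at h
    exact read_row hS hj hf c h
  · simp +contextual

theorem add_slice {n S : ℕ} (hn : 0 < n) (hS : n + 2 + n * n + n * n ≤ S)
    {i : ℕ} {t : ℝ} {A f : ℕ → ℝ} {inp coi : List ℝ}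
    (c : Config) (h : c.pc = 27 ∧ Layout n c.idx ∧ c.idx 6 = i ∧ Holds c.mem (n + 2) (n * n) A ∧
      Holds c.mem (n + 2 + n * n) (n * n) f ∧ c.mem n = t ∧ c.input = inp ∧ c.coins = coi) :
    tracePower.Reaches S c (2 + n * n * 5 + 2) fun c => c.pc = (if i + 1 < n then 14 else 36) ∧
      Layout n c.idx ∧ c.idx 6 = i + 1 ∧ Holds c.mem (n + 2) (n * n) (fun p => A p + t * f p) ∧
      c.input = inp ∧ c.coins = coi := by
  refine Program.Reaches.trans (T₁ := 2 + n * n * 5) (R := fun c => c.pc = 34 ∧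
      Layout n c.idx ∧ c.idx 6 = i ∧ Holds c.mem (n + 2) (n * n) (fun p => A p + t * f p) ∧
      c.input = inp ∧ c.coins = coi) ?_ ?_
  · obtain ⟨pc, idx, mem, inp', coi'⟩ := c
    simp only at h
    obtain ⟨rfl, hL, h6, hA, hB, ht, rfl, rfl⟩ := h
    have hL' := hL
    obtain ⟨h0, h2, h3, h4, h5⟩ := hL'
    rw [add_comm]
    refine .step _ rfl (by simp [Instr.addresses]) ?_
    refine .step _ rfl (by simp [Instr.addresses]) ?_
    -- Matrix and buffer are adjacent, so a single flat loop runs until the matrix pointer meets the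
    -- base of the buffer. Buffer cells are overwritten by trace times entry; the invariant
    -- therefore keeps the buffer only from position `p` on.
    refine (Program.Reaches.loop (N := n * n) (fun p c => c.pc = (if p < n * n then 29 else 34) ∧
      Layout n c.idx ∧ c.idx 6 = i ∧ c.idx 9 = n + 2 + p ∧ c.idx 10 = n + 2 + n * n + p ∧
      Holds c.mem (n + 2) (n * n) (fun q => if q < p then A q + t * f q else A q) ∧
      (∀ q < n * n, p ≤ q → c.mem (n + 2 + n * n + q) = f q) ∧ c.mem n = t ∧
      c.input = inp' ∧ c.coins = coi') ?_ ?_).mono le_rfl ?_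
    · simp [Instr.exec, Config.setReg, *, Layout.update]
      exact hB
    · rintro p hp ⟨pc, idx, mem, inp, coi⟩ h
      simp only [hp, if_true] at h
      obtain ⟨rfl, hL, h6, h9, h10, hA, hB, ht, rfl, rfl⟩ := h
      have hL' := hL
      obtain ⟨h0, h2, h3, h4, h5⟩ := hL'
      refine .step _ rfl (by simp [Instr.addresses, *]; omega) ?_
      simp only [Instr.exec, Config.write, h10, h2]
      refine .step _ rfl (by simp [Instr.addresses, *]; omega) ?_
      simp only [Instr.exec, Config.write, h9, h10]
      refine .step _ rfl (by simp [Instr.addresses]) ?_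
      refine .step _ rfl (by simp [Instr.addresses]) ?_
      refine .step _ rfl (by simp [Instr.addresses]) (.done ?_)
      simp [Instr.exec, Config.setReg, *, Layout.update, Op.eval]
      refine ⟨?_, by omega, by omega, fun q hq => ?_, fun q hq hpq => ?_, ?_⟩
      · by_cases h : p + 1 < n * n
        · rw [if_pos h, if_pos (by omega)]
        · rw [if_neg h, if_neg (by omega)]
      · obtain hqp | rfl | hqp := lt_trichotomy q p
        · rw [Function.update_of_ne (by omega), Function.update_of_ne (by omega), hA q hq]
          simp [hqp, hqp.le]
        · rw [Function.update_self, Function.update_of_ne (by omega), hA q hq]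
          simp
        · rw [Function.update_of_ne (by omega), Function.update_of_ne (by omega), hA q hq]
          simp [hqp.not_ge, hqp.not_gt]
      · rw [Function.update_of_ne (by omega), Function.update_of_ne (by omega),
          hB q hq (by omega)]
      · rw [Function.update_of_ne (by omega), Function.update_of_ne (by omega), ht]
    · rintro c ⟨h1, h2, h3, -, -, h4, -, -, h5, h6⟩
      refine ⟨by simpa using h1, h2, h3, h4.mono le_rfl fun p hp => by simp [hp], h5, h6⟩
  · rintro ⟨pc, idx, mem, inp, coi⟩ h
    simp only at h
    obtain ⟨rfl, hL, h6, hA, rfl, rfl⟩ := h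
    refine .step _ rfl (by simp [Instr.addresses]) ?_
    refine .step _ rfl (by simp [Instr.addresses]) (.done ?_)
    simp [Instr.exec, Config.setReg, *, Layout.update, hL.1]

/-- The partial trace matrix in row-major order, from the first `i` slices in the stream `inp`. -/
noncomputable def flatTrace (n : ℕ) (inp : List ℝ) (i p : ℕ) : ℝ :=
  ∑ a ∈ Finset.range i, (∑ l ∈ Finset.range n, inp.getD (a * (n * n) + (l * n + l)) 0) *
    inp.getD (a * (n * n) + p) 0

/-- The product of the matrix with row-major entries `G` and the vector `X`. -/
noncomputable def flatMul (n : ℕ) (G X : ℕ → ℝ) (j : ℕ) : ℝ :=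
  ∑ k ∈ Finset.range n, G (j * n + k) * X k

theorem accumulate {n S : ℕ} (hn : 0 < n) (hS : n + 2 + n * n + n * n ≤ S) {inp coi : List ℝ}
    (c : Config) (h : c.pc = 14 ∧ Layout n c.idx ∧ c.idx 6 = 0 ∧ c.mem = (fun _ => 0) ∧
      c.input = inp ∧ c.coins = coi) :
    tracePower.Reaches S c (n * (3 + n * (1 + n * 7 + 2) + (2 + n * n * 5 + 2))) fun c =>
      c.pc = 36 ∧ Layout n c.idx ∧ Holds c.mem (n + 2) (n * n) (flatTrace n inp n) ∧
      c.coins = coi := by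
  refine (Program.Reaches.loop (N := n) (fun i c => c.pc = (if i < n then 14 else 36) ∧
      Layout n c.idx ∧ c.idx 6 = i ∧ Holds c.mem (n + 2) (n * n) (flatTrace n inp i) ∧
      c.input = inp.drop (i * (n * n)) ∧ c.coins = coi) ?_ ?_).mono le_rfl ?_
  · obtain ⟨h1, h2, h3, h4, h5, h6⟩ := h
    exact ⟨by simp [h1, hn], h2, h3, fun p _ => by simp [h4, flatTrace], by simp [h5], h6⟩
  · intro i hi c h
    simp only [hi, if_true] at h
    refine (read_slice hn hS (f := fun p => inp.getD (i * (n * n) + p) 0) (fun _ _ => rfl) c h).trans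
      fun c' h' => (add_slice hn hS c' h').mono le_rfl ?_
    rintro c ⟨h1, h2, h3, h4, h5, h6⟩
    refine ⟨h1, h2, h3, h4.mono le_rfl fun p _ => by rw [flatTrace, flatTrace,
      Finset.sum_range_succ], ?_, h6⟩
    rw [h5, Nat.succ_mul]
  · rintro c ⟨h1, h2, h3, h4, h5, h6⟩
    exact ⟨by simpa using h1, h2, h4, h6⟩

theorem load_coins {n S : ℕ} (hn : 0 < n) (hS : n + 2 + n * n + n * n ≤ S) {coi : List ℝ}
    {G : ℕ → ℝ} (c : Config) (h : c.pc = 36 ∧ Layout n c.idx ∧ Holds c.mem (n + 2) (n * n) G ∧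
      c.coins = coi) :
    tracePower.Reaches S c (1 + n * 3 + 1) fun c => c.pc = 41 ∧ Layout n c.idx ∧ c.idx 6 = 0 ∧
      Holds c.mem 0 n (fun k => coi.getD k 0) ∧ Holds c.mem (n + 2) (n * n) G := by
  refine Program.Reaches.trans (T₁ := 1 + n * 3) (R := fun c => c.pc = 40 ∧ Layout n c.idx ∧
    Holds c.mem 0 n (fun k => coi.getD k 0) ∧ Holds c.mem (n + 2) (n * n) G) ?_ ?_
  · obtain ⟨pc, idx, mem, inp, coi'⟩ := c
    simp only at h
    obtain ⟨rfl, hL, hG, rfl⟩ := h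
    rw [add_comm 1 (n * 3)]
    refine .step _ rfl (by simp [Instr.addresses]) ?_
    refine (Program.Reaches.loop (N := n) (fun k c => c.pc = (if k < n then 37 else 40) ∧
      Layout n c.idx ∧ c.idx 6 = k ∧ Holds c.mem 0 k (fun k => coi'.getD k 0) ∧
      Holds c.mem (n + 2) (n * n) G ∧ c.coins = coi'.drop k) ?_ ?_).mono le_rfl ?_
    · simp [Instr.exec, Config.setReg, hL, hG, hn, Layout.update]
      exact fun p hp => by omega
    · rintro k hk ⟨pc, idx, mem, inp, coi⟩ h
      simp only [hk, if_true] at h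
      obtain ⟨rfl, hL, h6, hX, hG, rfl⟩ := h
      have hx : (coi'.drop k).headD 0 = coi'.getD k 0 := by
        rw [List.headD_eq_head?_getD, List.head?_drop, List.getD_eq_getElem?_getD]
      have hX' := hX.snoc (a := k) (x := coi'.getD k 0) (by omega) rfl
      refine .step _ rfl (by simp [Instr.addresses, h6]; omega) ?_
      simp only [Instr.exec, Config.write, h6, hx]
      refine .step _ rfl (by simp [Instr.addresses]) ?_
      refine .step _ rfl (by simp [Instr.addresses]) (.done ?_)
      simp only [Instr.exec, Config.setReg]
      refine ⟨by simp [hL.1, h6], hL.update (by omega), by simp [h6], hX', hG.update (by omega), ?_⟩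
      rw [List.tail_drop]
    · rintro c ⟨h1, h2, h3, h4, h5, h6⟩
      exact ⟨by simpa using h1, h2, h4, h5⟩
  · rintro ⟨pc, idx, mem, inp, coi⟩ h
    simp only at h
    obtain ⟨rfl, hL, hX, hG⟩ := h
    refine .step _ rfl (by simp [Instr.addresses]) (.done ?_)
    exact ⟨rfl, hL.update (by omega), by simp [Instr.exec, Config.setReg], hX, hG⟩

/-- The matrix pointer is not reset between rows: the row-major matrix is swept once per product,
which replaces the computation of `j * n + k`. -/
theorem mul_entry {n S j t : ℕ} (hS : n + 2 + n * n + n * n ≤ S) (hj : j < n) {G X Y : ℕ → ℝ}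
    (hY : Y j = flatMul n G X j)
    (c : Config) (h : c.pc = 44 ∧ Layout n c.idx ∧ c.idx 6 = t ∧ c.idx 7 = j ∧
      c.idx 9 = n + 2 + j * n ∧ c.idx 10 = n + 2 + n * n + j ∧ Holds c.mem 0 n X ∧
      Holds c.mem (n + 2) (n * n) G ∧ Holds c.mem (n + 2 + n * n) j Y) :
    tracePower.Reaches S c (2 + n * 5 + 3) fun c => c.pc = (if j + 1 < n then 44 else 54) ∧
      Layout n c.idx ∧ c.idx 6 = t ∧ c.idx 7 = j + 1 ∧
      c.idx 9 = n + 2 + (j + 1) * n ∧ c.idx 10 = n + 2 + n * n + (j + 1) ∧ Holds c.mem 0 n X ∧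
      Holds c.mem (n + 2) (n * n) G ∧ Holds c.mem (n + 2 + n * n) (j + 1) Y := by
  have hs : (j + 1) * n = j * n + n := by ring
  have hnn : n ≤ n * n := Nat.le_mul_self n
  refine Program.Reaches.trans (T₁ := 2 + n * 5) (R := fun c => c.pc = 51 ∧
      Layout n c.idx ∧ c.idx 6 = t ∧ c.idx 7 = j ∧
      c.idx 9 = n + 2 + (j + 1) * n ∧ c.idx 10 = n + 2 + n * n + j ∧ Holds c.mem 0 n X ∧
      Holds c.mem (n + 2) (n * n) G ∧ Holds c.mem (n + 2 + n * n) (j + 1) Y) ?_ ?_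
  · obtain ⟨pc, idx, mem, inp, coi⟩ := c
    simp only at h
    obtain ⟨rfl, hL, h6, h7, h9, h10, hX, hG, hB⟩ := h
    rw [add_comm 2 (n * 5)]
    refine .step _ rfl (by simp [Instr.addresses, h10]; omega) ?_
    simp only [Instr.exec, Config.write, h10]
    refine .step _ rfl (by simp [Instr.addresses]) ?_
    refine (Program.Reaches.loop (N := n) (fun k c => c.pc = (if k < n then 46 else 51) ∧
      Layout n c.idx ∧ c.idx 6 = t ∧ c.idx 7 = j ∧ c.idx 8 = k ∧
      c.idx 9 = n + 2 + (j * n + k) ∧ c.idx 10 = n + 2 + n * n + j ∧ Holds c.mem 0 n X ∧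
      Holds c.mem (n + 2) (n * n) G ∧ Holds c.mem (n + 2 + n * n) j Y ∧
      c.mem (n + 2 + n * n + j) = ∑ l ∈ Finset.range k, G (j * n + l) * X l) ?_ ?_).mono le_rfl ?_
    · simp [Instr.exec, Config.setReg, hL, Layout.update, h6, h7, h9, h10, show 0 < n by omega]
      exact ⟨hX.update (by omega), hG.update (by omega), hB.update (by omega)⟩
    · rintro k hk ⟨pc, idx, mem, inp, coi⟩ h
      simp only [hk, if_true] at h
      obtain ⟨rfl, hL, h6, h7, h8, h9, h10, hX, hG, hB, hm⟩ := h
      have hlt := flat_lt hj hk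
      have hXk := hX k hk
      rw [zero_add] at hXk
      refine .step _ rfl (by simp [Instr.addresses, hL.2.2.1, h8, h9]; omega) ?_
      simp only [Instr.exec, Config.write, hL.2.2.1, h8, h9, Op.eval, hXk, hG _ hlt]
      refine .step _ rfl (by simp [Instr.addresses, hL.2.2.1, h10]; omega) ?_
      simp only [Instr.exec, Config.write, hL.2.2.1, h10, Op.eval]
      refine .step _ rfl (by simp [Instr.addresses]) ?_
      refine .step _ rfl (by simp [Instr.addresses]) ?_
      refine .step _ rfl (by simp [Instr.addresses]) (.done ?_)
      simp [Instr.exec, Config.setReg, hL, hL.1, Layout.update, h6, h7, h8, h9, h10]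
      refine ⟨by omega, Holds.update (hX.update (by omega)) (by omega),
        Holds.update (hG.update (by omega)) (by omega),
        Holds.update (hB.update (by omega)) (by omega), ?_⟩
      rw [Function.update_of_ne (by omega), hm, Finset.sum_range_succ]
    · rintro c ⟨h1, h2, h3, h4, -, h5, h6, h7, h8, h9, h10⟩
      rw [hs]
      refine ⟨by simpa using h1, h2, h3, h4, h5, h6, h7, h8, fun p hp => ?_⟩
      obtain hp | rfl := Nat.lt_succ_iff_lt_or_eq.mp hp
      · exact h9 p hp
      · rw [h10, hY, flatMul]
  · rintro ⟨pc, idx, mem, inp, coi⟩ h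
    simp only at h
    obtain ⟨rfl, hL, h6, h7, h9, h10, hX, hG, hB⟩ := h
    refine .step _ rfl (by simp [Instr.addresses]) ?_
    refine .step _ rfl (by simp [Instr.addresses]) ?_
    refine .step _ rfl (by simp [Instr.addresses]) (.done ?_)
    simp [Instr.exec, Config.setReg, hL, hL.1, Layout.update, h6, h7, h9, h10, hX, hG, hB]
    omega

/-- Every row needs the old vector, so the product is built in the buffer, which is free by now, and
copied back at the end. -/
theorem mul_vec {n S t : ℕ} (hn : 0 < n) (hS : n + 2 + n * n + n * n ≤ S) {G X : ℕ → ℝ}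
    (c : Config) (h : c.pc = 41 ∧ Layout n c.idx ∧ c.idx 6 = t ∧ Holds c.mem 0 n X ∧
      Holds c.mem (n + 2) (n * n) G) :
    tracePower.Reaches S c (3 + n * (2 + n * 5 + 3) + (2 + n * 4 + 2)) fun c =>
      c.pc = (if t + 1 < n then 41 else 62) ∧ Layout n c.idx ∧ c.idx 6 = t + 1 ∧
      Holds c.mem 0 n (flatMul n G X) ∧ Holds c.mem (n + 2) (n * n) G := by
  have hnn : n ≤ n * n := Nat.le_mul_self n
  refine Program.Reaches.trans (T₁ := 3 + n * (2 + n * 5 + 3)) (R := fun c => c.pc = 54 ∧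
      Layout n c.idx ∧ c.idx 6 = t ∧ Holds c.mem (n + 2) (n * n) G ∧
      Holds c.mem (n + 2 + n * n) n (flatMul n G X)) ?_ fun c h => ?_
  · obtain ⟨pc, idx, mem, inp, coi⟩ := c
    simp only at h
    obtain ⟨rfl, hL, h6, hX, hG⟩ := h
    rw [add_comm 3]
    refine .step _ rfl (by simp [Instr.addresses]) ?_
    refine .step _ rfl (by simp [Instr.addresses]) ?_
    refine .step _ rfl (by simp [Instr.addresses]) ?_
    refine (Program.Reaches.loop (N := n) (fun j c => c.pc = (if j < n then 44 else 54) ∧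
      Layout n c.idx ∧ c.idx 6 = t ∧ c.idx 7 = j ∧
      c.idx 9 = n + 2 + j * n ∧ c.idx 10 = n + 2 + n * n + j ∧ Holds c.mem 0 n X ∧
      Holds c.mem (n + 2) (n * n) G ∧ Holds c.mem (n + 2 + n * n) j (flatMul n G X))
      ?_ ?_).mono le_rfl ?_
    · simp [Instr.exec, Config.setReg, hL.2.2.2.1, hL.2.2.2.2, h6, hX, hG, hn]
      exact ⟨((hL.update (by omega)).update (by omega)).update (by omega), fun p hp => by omega⟩
    · intro j hj c h
      simp only [hj, if_true] at h
      exact mul_entry hS hj rfl c h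
    · rintro c ⟨h1, h2, h3, h4, h5, h6, h7, h8, h9⟩
      exact ⟨by simpa using h1, h2, h3, h8, h9⟩
  · refine Program.Reaches.trans (T₁ := 2 + n * 4) (R := fun c => c.pc = 60 ∧
      Layout n c.idx ∧ c.idx 6 = t ∧ Holds c.mem 0 n (flatMul n G X) ∧
      Holds c.mem (n + 2) (n * n) G) ?_ ?_
    · obtain ⟨pc, idx, mem, inp, coi⟩ := c
      simp only at h
      obtain ⟨rfl, hL, h6, hG, hB⟩ := h
      rw [add_comm 2]
      refine .step _ rfl (by simp [Instr.addresses]) ?_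
      refine .step _ rfl (by simp [Instr.addresses]) ?_
      refine (Program.Reaches.loop (N := n) (fun j c => c.pc = (if j < n then 56 else 60) ∧
        Layout n c.idx ∧ c.idx 6 = t ∧ c.idx 7 = j ∧ c.idx 10 = n + 2 + n * n + j ∧
        Holds c.mem 0 j (flatMul n G X) ∧ Holds c.mem (n + 2) (n * n) G ∧
        Holds c.mem (n + 2 + n * n) n (flatMul n G X)) ?_ ?_).mono le_rfl ?_
      · simp [Instr.exec, Config.setReg, hL, hL.2.2.2.2, Layout.update, h6, hB, hG, hn]
        exact fun p hp => by omega
      · rintro j hj ⟨pc, idx, mem, inp, coi⟩ h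
        simp only [hj, if_true] at h
        obtain ⟨rfl, hL, h6, h7, h10, hX, hG, hB⟩ := h
        have hX' := hX.snoc (a := j) (x := flatMul n G X j) (by omega) rfl
        refine .step _ rfl (by simp [Instr.addresses, h7, h10]; omega) ?_
        simp only [Instr.exec, Config.write, h7, h10, hB j hj]
        refine .step _ rfl (by simp [Instr.addresses]) ?_
        refine .step _ rfl (by simp [Instr.addresses]) ?_
        refine .step _ rfl (by simp [Instr.addresses]) (.done ?_)
        simp [Instr.exec, Config.setReg, hL, hL.1, Layout.update, h6, h7, h10, hX']
        exact ⟨by omega, hG.update (by omega), hB.update (by omega)⟩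
      · rintro c ⟨h1, h2, h3, h4, h5, h6, h7, h8⟩
        exact ⟨by simpa using h1, h2, h3, h6, h7⟩
    · rintro ⟨pc, idx, mem, inp, coi⟩ h
      simp only at h
      obtain ⟨rfl, hL, h6, hX, hG⟩ := h
      refine .step _ rfl (by simp [Instr.addresses]) ?_
      refine .step _ rfl (by simp [Instr.addresses]) (.done ?_)
      simp [Instr.exec, Config.setReg, hL, hL.1, Layout.update, h6, hX, hG]

/-- Arithmetic is exact, so nothing is normalized between the products. -/
theorem power_loop {n S : ℕ} (hn : 0 < n) (hS : n + 2 + n * n + n * n ≤ S) {G X : ℕ → ℝ}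
    (c : Config) (h : c.pc = 41 ∧ Layout n c.idx ∧ c.idx 6 = 0 ∧ Holds c.mem 0 n X ∧
      Holds c.mem (n + 2) (n * n) G) :
    tracePower.Reaches S c (n * (3 + n * (2 + n * 5 + 3) + (2 + n * 4 + 2))) fun c =>
      c.pc = 62 ∧ Layout n c.idx ∧ Holds c.mem 0 n ((flatMul n G)^[n] X) := by
  refine (Program.Reaches.loop (N := n) (fun t c => c.pc = (if t < n then 41 else 62) ∧
    Layout n c.idx ∧ c.idx 6 = t ∧ Holds c.mem 0 n ((flatMul n G)^[t] X) ∧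
      Holds c.mem (n + 2) (n * n) G) ?_ ?_).mono le_rfl ?_
  · simpa [hn] using h
  · intro t ht c h
    simp only [ht, if_true] at h
    rw [Function.iterate_succ_apply']
    exact mul_vec hn hS c h
  · rintro c ⟨h1, h2, h3, h4, h5⟩
    exact ⟨by simpa using h1, h2, h4⟩

theorem normalize_vec {n S : ℕ} (hn : 0 < n) (hS : n + 2 + n * n + n * n ≤ S) {X : ℕ → ℝ}
    (c : Config) (h : c.pc = 62 ∧ Layout n c.idx ∧ Holds c.mem 0 n X) :
    tracePower.Reaches S c (2 + n * 4 + (2 + n * 3)) fun c => c.pc = 73 ∧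
      ∀ k < n, c.mem k = X k / √(∑ l ∈ Finset.range n, X l * X l) := by
  refine Program.Reaches.trans (T₁ := 2 + n * 4) (R := fun c => c.pc = 68 ∧
      Layout n c.idx ∧ Holds c.mem 0 n X ∧ c.mem n = ∑ l ∈ Finset.range n, X l * X l) ?_ ?_
  · obtain ⟨pc, idx, mem, inp, coi⟩ := c
    simp only at h
    obtain ⟨rfl, hL, hX⟩ := h
    rw [add_comm 2]
    refine .step _ rfl (by simp [Instr.addresses, hL.2.1]; omega) ?_
    simp only [Instr.exec, Config.write, hL.2.1]
    refine .step _ rfl (by simp [Instr.addresses]) ?_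
    refine (Program.Reaches.loop (N := n) (fun k c => c.pc = (if k < n then 64 else 68) ∧
      Layout n c.idx ∧ c.idx 7 = k ∧ Holds c.mem 0 n X ∧
      c.mem n = ∑ l ∈ Finset.range k, X l * X l) ?_ ?_).mono le_rfl ?_
    · simp [Instr.exec, Config.setReg, hL, Layout.update, hn]
      exact hX.update (by omega)
    · rintro k hk ⟨pc, idx, mem, inp, coi⟩ h
      simp only [hk, if_true] at h
      obtain ⟨rfl, hL, h7, hX, hm⟩ := h
      have hXk := hX k hk
      rw [zero_add] at hXk
      refine .step _ rfl (by simp [Instr.addresses, hL.2.2.1, h7]; omega) ?_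
      simp only [Instr.exec, Config.write, hL.2.2.1, h7, Op.eval, hXk]
      refine .step _ rfl (by simp [Instr.addresses, hL.2.2.1, hL.2.1]; omega) ?_
      simp only [Instr.exec, Config.write, hL.2.2.1, hL.2.1, Op.eval]
      refine .step _ rfl (by simp [Instr.addresses]) ?_
      refine .step _ rfl (by simp [Instr.addresses]) (.done ?_)
      simp [Instr.exec, Config.setReg, hL, hL.1, Layout.update, h7]
      refine ⟨Holds.update (hX.update (by omega)) (by omega), ?_⟩
      rw [hm, Finset.sum_range_succ]
    · rintro c ⟨h1, h2, h3, h4, h5⟩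
      exact ⟨by simpa using h1, h2, h4, h5⟩
  · rintro ⟨pc, idx, mem, inp, coi⟩ h
    simp only at h
    obtain ⟨rfl, hL, hX, hm⟩ := h
    rw [add_comm 2]
    refine .step _ rfl (by simp [Instr.addresses, hL.2.1]; omega) ?_
    simp only [Instr.exec, Config.write, hL.2.1, hm]
    refine .step _ rfl (by simp [Instr.addresses]) ?_
    refine (Program.Reaches.loop (N := n) (fun k c => c.pc = (if k < n then 70 else 73) ∧
      Layout n c.idx ∧ c.idx 7 = k ∧ c.mem n = √(∑ l ∈ Finset.range n, X l * X l) ∧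
      (∀ p < n, c.mem p = if p < k then X p / √(∑ l ∈ Finset.range n, X l * X l) else X p))
      ?_ ?_).mono le_rfl ?_
    · simp [Instr.exec, Config.setReg, hL, Layout.update, hn]
      intro p hp
      rw [Function.update_of_ne (by omega), ← hX p hp, zero_add]
    · rintro k hk ⟨pc, idx, mem, inp, coi⟩ h
      simp only [hk, if_true] at h
      obtain ⟨rfl, hL, h7, hm, hX⟩ := h
      have hXk := hX k hk
      rw [if_neg (lt_irrefl k)] at hXk
      refine .step _ rfl (by simp [Instr.addresses, hL.2.1, h7]; omega) ?_
      simp only [Instr.exec, Config.write, hL.2.1, h7, Op.eval, hXk, hm]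
      refine .step _ rfl (by simp [Instr.addresses]) ?_
      refine .step _ rfl (by simp [Instr.addresses]) (.done ?_)
      simp [Instr.exec, Config.setReg, hL, hL.1, Layout.update, h7]
      refine ⟨by rw [Function.update_of_ne (by omega), hm], fun p hp => ?_⟩
      obtain hpk | rfl | hpk := lt_trichotomy p k
      · rw [Function.update_of_ne (by omega), hX p hp]
        simp [hpk, hpk.le]
      · simp
      · rw [Function.update_of_ne (by omega), hX p hp]
        simp [hpk.not_gt, hpk.not_ge]
    · rintro c ⟨h1, h2, h3, h4, h5⟩
      exact ⟨by simpa using h1, fun k hk => by simp [h5 k hk, hk]⟩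

theorem iterate_step_of_length_le {P : Program} {c : Config} (h : P.length ≤ c.pc) (t : ℕ) :
    P.step^[t] c = c :=
  Function.iterate_fixed (by simp [Program.step, List.getElem?_eq_none h]) t

theorem tracePower_reaches {n : ℕ} (hn : 0 < n) (inp coi : List ℝ) :
    tracePower.Reaches (100 * n ^ 2) (initial n inp coi) (100 * n ^ 3) fun c => c.pc = 73 ∧
      ∀ k < n, c.mem k = (flatMul n (flatTrace n inp n))^[n] (fun k => coi.getD k 0) k /
        √(∑ l ∈ Finset.range n, (flatMul n (flatTrace n inp n))^[n] (fun k => coi.getD k 0) l *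
          (flatMul n (flatTrace n inp n))^[n] (fun k => coi.getD k 0) l) := by
  have h1 : n ≤ n ^ 2 := Nat.le_self_pow (by norm_num) n
  have h2 : n ^ 2 ≤ n ^ 3 := Nat.pow_le_pow_right hn (by norm_num)
  have hS : n + 2 + n * n + n * n ≤ 100 * n ^ 2 := by nlinarith
  refine (((((setup hn inp coi).trans fun c h => accumulate hn hS c h).trans
    fun c h => load_coins hn hS c h).trans fun c h => power_loop hn hS c h).trans
    fun c h => normalize_vec hn hS c h).mono ?_ fun c h => h
  -- The total is `17 n³ + 15 n² + 27 n + 14`, which is at most `73 n³`.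
  ring_nf
  omega

/-- A halted configuration is a fixed point of `step` and addresses no cell, so the bounds persist
up to any larger time. -/
theorem tracePower_runsWithin {n : ℕ} (hn : 0 < n) (inp coi : List ℝ) {K : ℕ} (hK : 100 ≤ K) :
    tracePower.RunsWithin n inp coi (K * n ^ 3) (K * n ^ 2) ∧
      ∀ k < n, (tracePower.run n inp coi (K * n ^ 3)).mem k =
        (flatMul n (flatTrace n inp n))^[n] (fun k => coi.getD k 0) k /
        √(∑ l ∈ Finset.range n, (flatMul n (flatTrace n inp n))^[n] (fun k => coi.getD k 0) l *
          (flatMul n (flatTrace n inp n))^[n] (fun k => coi.getD k 0) l) := by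
  obtain ⟨k, hk, ⟨hpc, hmem⟩, hadr⟩ := tracePower_reaches hn inp coi
  have hk' : k ≤ K * n ^ 3 := hk.trans (Nat.mul_le_mul_right _ hK)
  have hlen : tracePower.length ≤ (tracePower.step^[k] (initial n inp coi)).pc := hpc.ge
  have hrun (t : ℕ) (ht : k ≤ t) : tracePower.step^[t] (initial n inp coi) =
      tracePower.step^[k] (initial n inp coi) := by
    obtain ⟨s, rfl⟩ := Nat.exists_eq_add_of_le' ht
    rw [Function.iterate_add_apply, iterate_step_of_length_le hlen]
  refine ⟨⟨by rw [Program.run, hrun _ hk']; exact hlen, fun t _ p hp => ?_⟩, ?_⟩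
  · by_cases htk : t < k
    · exact (hadr t htk p hp).trans_le (Nat.mul_le_mul_right _ hK)
    · rw [Program.run, hrun t (by omega), Program.addresses, List.getElem?_eq_none hlen] at hp
      simp at hp
  · rw [Program.run, hrun _ hk']
    exact hmem

end RealRAM

/-! ### From memory contents to the trace matrix and the power method -/

namespace TensorPCA

theorem getD_flatMap_finRange {α : Type*} {n L : ℕ} (f : Fin n → List α)
    (hf : ∀ i, (f i).length = L) (i : Fin n) {p : ℕ} (hp : p < L) (d : α) :
    ((List.finRange n).flatMap f).getD (i * L + p) d = (f i).getD p d := by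
  induction n with
  | zero => exact i.elim0
  | succ n ih =>
    rw [List.finRange_succ, List.flatMap_cons, List.flatMap_map]
    refine Fin.cases ?_ (fun i => ?_) i
    · rw [List.getD_append _ _ _ _ (by simp [hf, hp])]
      simp
    · rw [List.getD_append_right _ _ _ _ (by rw [hf, Fin.val_succ, Nat.succ_mul]; omega), hf,
        ← ih (fun i => f i.succ) (fun i => hf _) i]
      congr 1
      rw [Fin.val_succ, Nat.succ_mul]
      omega

theorem getD_stream {n : ℕ} (T : Tensor n) (i j k : Fin n) :
    (stream T).getD (i * (n * n) + (j * n + k)) 0 = T (i, j, k) := by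
  have h (i j : Fin n) : ((List.finRange n).map fun k => T (i, j, k)).length = n := by simp
  rw [stream, getD_flatMap_finRange _ _ _ (RealRAM.flat_lt j.2 k.2),
    getD_flatMap_finRange _ (h i) _ k.2]
  · simp
  · simp

/-- Each slice contributes `Tr(T_i) T_i` on its own, which is what makes a single pass with
quadratic memory possible. -/
theorem traceMatrix_apply {n : ℕ} (T : Tensor n) (j k : Fin n) :
    traceMatrix T j k = ∑ i, (∑ a, T (i, a, a)) * T (i, j, k) := by
  simp only [traceMatrix, partialTrace, Matrix.of_apply, Matrix.sum_apply, Matrix.kroneckerMap_apply,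
    slice]
  rw [Finset.sum_comm]
  simp [Finset.sum_mul]

theorem flatTrace_stream {n : ℕ} (T : Tensor n) (j k : Fin n) :
    RealRAM.flatTrace n (stream T) n (j * n + k) = traceMatrix T j k := by
  simp [RealRAM.flatTrace, traceMatrix_apply, Finset.sum_range, getD_stream, -List.getD_eq_getElem?_getD]

theorem flatMul_iterate {n : ℕ} (M : Matrix (Fin n) (Fin n) ℝ) {G X : ℕ → ℝ}
    (hG : ∀ j k : Fin n, G (j * n + k) = M j k) {x : EuclideanSpace ℝ (Fin n)}
    (hX : ∀ k : Fin n, X k = x k) (t : ℕ) (j : Fin n) :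
    (RealRAM.flatMul n G)^[t] X j = (M.toEuclideanLin^[t] x) j := by
  induction t generalizing j with
  | zero => exact hX j
  | succ t ih =>
    rw [Function.iterate_succ_apply', Function.iterate_succ_apply', RealRAM.flatMul,
      Finset.sum_range]
    simp [hG, ih, Matrix.toLpLin_apply, Matrix.mulVec, dotProduct]

theorem tracePower_output {n : ℕ} (hn : 0 < n) (T : Tensor n) (g : Fin n → ℝ) {K : ℕ}
    (hK : 100 ≤ K) :
    RealRAM.tracePower.output n (stream T) (List.ofFn g) (K * n ^ 3) =
      ‖(traceMatrix T).toEuclideanLin^[n] (WithLp.toLp 2 g)‖⁻¹ •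
        (traceMatrix T).toEuclideanLin^[n] (WithLp.toLp 2 g) := by
  have hX (k : Fin n) : (fun k => (List.ofFn g).getD k 0) (k : ℕ) =
      (WithLp.toLp 2 g : EuclideanSpace ℝ (Fin n)) k := by simp
  have h := flatMul_iterate (X := fun k => (List.ofFn g).getD k 0) (traceMatrix T)
    (flatTrace_stream T) hX n
  ext k
  rw [RealRAM.Program.output]
  simp only
  rw [(RealRAM.tracePower_runsWithin hn _ _ hK).2 k k.2, Finset.sum_range]
  simp only [h]
  rw [EuclideanSpace.norm_eq]
  simp only [Real.norm_eq_abs, sq_abs, ← sq, PiLp.smul_apply, smul_eq_mul]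
  rw [div_eq_inv_mul]

/-- Normalizing at every step only rescales. No iterate has to be nonzero: from the first zero
iterate on, both sides vanish because `0⁻¹ = 0`. -/
theorem powerIterate_eq {n : ℕ} (M : Matrix (Fin n) (Fin n) ℝ) (x : EuclideanSpace ℝ (Fin n))
    (t : ℕ) : powerIterate M x t = ‖M.toEuclideanLin^[t] x‖⁻¹ • M.toEuclideanLin^[t] x := by
  induction t with
  | zero => rfl
  | succ t ih =>
    rw [powerIterate, ih, Function.iterate_succ_apply']
    generalize M.toEuclideanLin^[t] x = y
    rcases eq_or_ne y 0 with rfl | hy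
    · simp
    · rw [map_smul, norm_smul, norm_inv, norm_norm, mul_inv, inv_inv, smul_smul, mul_right_comm,
        mul_inv_cancel₀ (norm_ne_zero_iff.mpr hy), one_mul]

/-! ### Nonsymmetric perturbations of a rank-one projection -/

section RankOne

variable {V : Type*} [NormedAddCommGroup V] [InnerProductSpace ℝ V] [CompleteSpace V]

open scoped RealInnerProductSpace

omit [CompleteSpace V] in
theorem norm_le_of_smul_eq_add {E : V →L[ℝ] V} {u v : V} {r η : ℝ} (hv : ‖v‖ = 1) (hE : ‖E‖ ≤ η)
    (hr : η < r) (h : r • u = v + E u) : ‖u‖ ≤ 1 / (r - η) := by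
  have hη : 0 ≤ η := (norm_nonneg _).trans hE
  have h1 : r * ‖u‖ ≤ 1 + η * ‖u‖ := by
    calc r * ‖u‖ = ‖r • u‖ := by rw [norm_smul, Real.norm_of_nonneg (by linarith)]
      _ ≤ ‖v‖ + ‖E u‖ := h ▸ norm_add_le _ _
      _ ≤ _ := by
        rw [hv]
        gcongr
        exact E.le_of_opNorm_le hE u
  rw [le_div_iff₀ (by linarith)]
  linarith

/-- A small perturbation of the projection onto a unit vector `v` has an eigenvalue near `1`, with
an eigenvector near `v`. -/
theorem exists_eigenvector_of_norm_le {E : V →L[ℝ] V} {v : V} {η : ℝ} (hv : ‖v‖ = 1)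
    (hE : ‖E‖ ≤ η) (hη : η ≤ 1 / 12) :
    ∃ r ∈ Set.Icc (1 - 2 * η) (1 + 2 * η), ∃ u, ⟪v, u⟫ = 1 ∧ r • u = v + E u ∧ ‖u‖ ≤ 2 ∧
      ‖u - v‖ ≤ 4 * η := by
  have hη0 : 0 ≤ η := (norm_nonneg _).trans hE
  have : Nontrivial V := ⟨⟨v, 0, fun h => by simp [h] at hv⟩⟩
  have hmem (r : ℝ) (hr : r ∈ Set.Icc (1 - 2 * η) (1 + 2 * η)) : r ∈ resolventSet ℝ E := by
    apply spectrum.mem_resolventSet_of_norm_lt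
    rw [Real.norm_of_nonneg (by linarith [hr.1])]
    linarith [hr.1]
  -- The vector `u(r) = (r - E)⁻¹ v` satisfies `r u = v + E u`. It is an eigenvector of `v vᵀ + E`
  -- as soon as `⟪v, u(r)⟫ = 1`, and this equation determines `r`.
  have heq (r : ℝ) (hr : r ∈ Set.Icc (1 - 2 * η) (1 + 2 * η)) :
      r • resolvent E r v = v + E (resolvent E r v) := by
    have h1 : (algebraMap ℝ (V →L[ℝ] V) r - E) * resolvent E r = 1 :=
      Ring.mul_inverse_cancel _ (hmem r hr)
    have h2 := DFunLike.congr_fun h1 v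
    simp [Algebra.algebraMap_eq_smul_one] at h2
    exact sub_eq_iff_eq_add.mp h2
  have hnorm (r : ℝ) (hr : r ∈ Set.Icc (1 - 2 * η) (1 + 2 * η)) :
      ‖resolvent E r v‖ ≤ 1 / (r - η) :=
    norm_le_of_smul_eq_add hv hE (by linarith [hr.1]) (heq r hr)
  have hinner (r : ℝ) (hr : r ∈ Set.Icc (1 - 2 * η) (1 + 2 * η)) :
      |r * ⟪v, resolvent E r v⟫ - 1| ≤ η / (r - η) := by
    have h1 : r * ⟪v, resolvent E r v⟫ - 1 = ⟪v, E (resolvent E r v)⟫ := by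
      rw [← real_inner_smul_right, heq r hr, inner_add_right, real_inner_self_eq_norm_sq, hv]
      ring
    rw [h1]
    calc _ ≤ ‖v‖ * ‖E (resolvent E r v)‖ := abs_real_inner_le_norm _ _
      _ ≤ η * ‖resolvent E r v‖ := by
        rw [hv, one_mul]
        exact E.le_of_opNorm_le hE _
      _ ≤ η * (1 / (r - η)) := by gcongr; exact hnorm r hr
      _ = _ := by ring
  have hcont : ContinuousOn (fun r => ⟪v, resolvent E r v⟫) (Set.Icc (1 - 2 * η) (1 + 2 * η)) := by
    intro r hr
    have h1 : ContinuousAt (resolvent E) r := (spectrum.hasDerivAt_resolvent_const_left (hmem r hr)).continuousAt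
    have h2 : ContinuousAt (fun r => resolvent E r v) r := h1.clm_apply continuousAt_const
    exact (continuousAt_const.inner h2).continuousWithinAt
  have hl : 1 - 2 * η ∈ Set.Icc (1 - 2 * η) (1 + 2 * η) := ⟨le_rfl, by linarith⟩
  have hr : 1 + 2 * η ∈ Set.Icc (1 - 2 * η) (1 + 2 * η) := ⟨by linarith, le_rfl⟩
  -- By `hinner`, `⟪v, u(r)⟫` is at least `1` at the left endpoint and at most `1` at the right one.
  obtain ⟨r, hrm, hr1⟩ := intermediate_value_Icc' (by linarith) hcont
    (show (1 : ℝ) ∈ Set.Icc _ _ by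
      constructor
      · have h := (abs_le.mp (hinner _ hr)).2
        have h' : η / (1 + 2 * η - η) ≤ η := div_le_self hη0 (by linarith)
        nlinarith
      · have h := (abs_le.mp (hinner _ hl)).1
        have h' : η / (1 - 2 * η - η) ≤ 2 * η := by
          rw [div_le_iff₀ (by linarith)]
          nlinarith
        nlinarith)
  have hu := hnorm r hrm
  have hu' : 1 / (r - η) ≤ 4 / 3 := by
    rw [div_le_iff₀ (by linarith [hrm.1])]
    linarith [hrm.1]
  refine ⟨r, hrm, resolvent E r v, hr1, heq r hrm, by linarith, ?_⟩
  -- The right side has norm at most `2 η + (4/3) η`, and `r ≥ 5/6`; the quotient is `4 η`.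
  have h1 : r • (resolvent E r v - v) = (1 - r) • v + E (resolvent E r v) := by
    rw [smul_sub, heq r hrm, sub_smul, one_smul]
    abel
  have h2 : r * ‖resolvent E r v - v‖ ≤ 2 * η + η * (4 / 3) := by
    calc r * ‖resolvent E r v - v‖ = ‖r • (resolvent E r v - v)‖ := by
          rw [norm_smul, Real.norm_of_nonneg (by linarith [hrm.1])]
      _ ≤ ‖(1 - r) • v‖ + ‖E (resolvent E r v)‖ := h1 ▸ norm_add_le _ _
      _ ≤ 2 * η + η * (4 / 3) := by
        gcongr
        · rw [norm_smul, hv, mul_one, Real.norm_eq_abs, abs_le]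
          constructor <;> linarith [hrm.1, hrm.2]
        · exact E.le_of_opNorm_le_of_le hE (hu.trans hu')
  nlinarith [norm_nonneg (resolvent E r v - v), hrm.1]

/-- `F` has a simple dominant eigenvalue `lam` with right eigenvector `u` and left eigenvector `l`,
and is `ρ * lam`-bounded on the invariant complement of `u`. -/
structure Dominant (F : V →L[ℝ] V) (v : V) (lam ρ : ℝ) (u l : V) : Prop where
  inner_right : ⟪v, u⟫ = 1
  inner_left : ⟪v, l⟫ = 1
  map_right : F u = lam • u
  map_left : F.adjoint l = lam • l
  inner_pos : 3 / 4 ≤ ⟪l, u⟫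
  norm_right : ‖u‖ ≤ 2
  norm_left : ‖l‖ ≤ 2
  contract : ∀ w, ⟪l, w⟫ = 0 → ‖F w‖ ≤ ρ * lam * ‖w‖

/-- The eigenvector lemma applies to `N / β` and to its adjoint. The two eigenvalues agree because
`⟪l, u⟫ ≠ 0`. If `w` is orthogonal to `l`, then `⟪v, w⟫ = -⟪l - v, w⟫` is at most `4 η ‖w‖`, so the
rank-one part is as small as the noise there: `‖F w‖ ≤ 5 η β ‖w‖`, and `5 ≤ 6 r` turns `β` into `lam
= β r`. -/
theorem exists_dominant {F N : V →L[ℝ] V} {v : V} {β η : ℝ} (hv : ‖v‖ = 1) (hβ : 0 < β)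
    (hF : ∀ x, F x = (β * ⟪v, x⟫) • v + N x) (hN : ‖N‖ ≤ η * β) (hη : η ≤ 1 / 12) :
    ∃ lam ≥ β * (1 - 2 * η), ∃ u l, Dominant F v lam (6 * η) u l := by
  have hη0 : 0 ≤ η := by
    have := (norm_nonneg _).trans hN
    by_contra! h
    nlinarith
  have hE : ‖β⁻¹ • N‖ ≤ η := by
    rw [norm_smul, norm_inv, Real.norm_of_nonneg hβ.le, inv_mul_le_iff₀ hβ]
    linarith
  have hE' : ‖(β⁻¹ • N).adjoint‖ ≤ η := by rwa [LinearIsometryEquiv.norm_map]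
  obtain ⟨r, hr, u, hvu, hu, hu2, huv⟩ := exists_eigenvector_of_norm_le hv hE hη
  obtain ⟨s, hs, l, hvl, hl, hl2, hlv⟩ := exists_eigenvector_of_norm_le hv hE' hη
  have hFu : F u = (β * r) • u := by
    rw [mul_smul, hu, hF, hvu, smul_add, mul_one, smul_apply,
      smul_inv_smul₀ hβ.ne']
  have hFl : F.adjoint l = (β * s) • l := by
    refine ext_inner_right ℝ fun x => ?_
    rw [ContinuousLinearMap.adjoint_inner_left, hF, mul_smul β s l, hl, inner_add_right,
      real_inner_smul_right, real_inner_comm v l, hvl, real_inner_smul_left, inner_add_left,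
      ContinuousLinearMap.adjoint_inner_left, smul_apply,
      real_inner_smul_right, mul_add, mul_inv_cancel_left₀ hβ.ne', mul_one]
  have hlu : 3 / 4 ≤ ⟪l, u⟫ := by
    have h1 : ⟪l, u⟫ = 1 + ⟪l - v, u - v⟫ := by
      rw [inner_sub_left, inner_sub_right, inner_sub_right, hvu, real_inner_comm v l, hvl,
        real_inner_self_eq_norm_sq, hv]
      ring
    have h2 := (abs_le.mp (abs_real_inner_le_norm (l - v) (u - v))).1
    have h3 : ‖l - v‖ * ‖u - v‖ ≤ (4 * η) * (4 * η) := by gcongr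
    nlinarith
  have hrs : r = s := by
    have h1 : ⟪l, F u⟫ = ⟪F.adjoint l, u⟫ := by rw [ContinuousLinearMap.adjoint_inner_left]
    rw [hFu, hFl, real_inner_smul_left, real_inner_smul_right] at h1
    exact mul_left_cancel₀ hβ.ne' (mul_right_cancel₀ (by linarith) h1)
  subst hrs
  refine ⟨β * r, ?_, u, l, hvu, hvl, hFu, hFl, hlu, hu2, hl2, fun w hw => ?_⟩
  · gcongr
    exact hr.1
  · have h1 : |⟪v, w⟫| ≤ 4 * η * ‖w‖ := by
      have : ⟪v, w⟫ = -⟪l - v, w⟫ := by rw [inner_sub_left, hw]; ring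
      rw [this, abs_neg]
      exact (abs_real_inner_le_norm _ _).trans (by gcongr)
    calc ‖F w‖ ≤ ‖(β * ⟪v, w⟫) • v‖ + ‖N w‖ := hF w ▸ norm_add_le _ _
      _ ≤ β * (4 * η * ‖w‖) + η * β * ‖w‖ := by
        gcongr
        · rw [norm_smul, hv, mul_one, norm_mul, Real.norm_of_nonneg hβ.le, Real.norm_eq_abs]
          gcongr
        · exact N.le_of_opNorm_le hN w
      _ = 5 * (η * β * ‖w‖) := by ring
      _ ≤ 6 * r * (η * β * ‖w‖) := by
        gcongr
        linarith [hr.1]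
      _ = _ := by ring

omit [CompleteSpace V] in
theorem iterate_sub_smul (F : V →L[ℝ] V) (t : ℕ) (x u : V) (a : ℝ) :
    F^[t] (x - a • u) = F^[t] x - a • F^[t] u := by
  induction t with
  | zero => rfl
  | succ t ih => simp only [Function.iterate_succ_apply', ih, map_sub, map_smul]

theorem inner_adjoint_iterate (F : V →L[ℝ] V) (t : ℕ) (x y : V) :
    ⟪F.adjoint^[t] x, y⟫ = ⟪x, F^[t] y⟫ := by
  induction t generalizing y with
  | zero => rfl
  | succ t ih =>
    rw [Function.iterate_succ_apply', ContinuousLinearMap.adjoint_inner_left, ih,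
      Function.iterate_succ_apply]

namespace Dominant

variable {F : V →L[ℝ] V} {v u l : V} {lam ρ : ℝ}

theorem iterate_right (h : Dominant F v lam ρ u l) (t : ℕ) : F^[t] u = lam ^ t • u := by
  induction t with
  | zero => simp
  | succ t ih => rw [Function.iterate_succ_apply', ih, map_smul, h.map_right, smul_smul, pow_succ]

theorem inner_left_map (h : Dominant F v lam ρ u l) (w : V) : ⟪l, F w⟫ = lam * ⟪l, w⟫ := by
  rw [← ContinuousLinearMap.adjoint_inner_left, h.map_left, real_inner_smul_left]

theorem contract_iterate (h : Dominant F v lam ρ u l) (hlam : 0 ≤ lam) (hρ : 0 ≤ ρ) {w : V}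
    (hw : ⟪l, w⟫ = 0) (t : ℕ) : ⟪l, F^[t] w⟫ = 0 ∧ ‖F^[t] w‖ ≤ (ρ * lam) ^ t * ‖w‖ := by
  induction t with
  | zero => simp [hw]
  | succ t ih =>
    rw [Function.iterate_succ_apply', h.inner_left_map, ih.1, mul_zero]
    refine ⟨rfl, (h.contract _ ih.1).trans ?_⟩
    rw [pow_succ', mul_assoc (ρ * lam) ((ρ * lam) ^ t)]
    exact mul_le_mul_of_nonneg_left ih.2 (by positivity)

/-- The iterates of `x` approach the component of `x` along the dominant eigenvector. -/
theorem norm_iterate_sub_le (h : Dominant F v lam ρ u l) (hlam : 0 < lam) (hρ : 0 ≤ ρ) (x : V)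
    (t : ℕ) : ‖F^[t] x - (lam ^ t * (⟪l, x⟫ / ⟪l, u⟫)) • u‖ ≤ lam ^ t * (ρ ^ t * (7 * ‖x‖)) := by
  have hpos : 0 < ⟪l, u⟫ := by linarith [h.inner_pos]
  set a := ⟪l, x⟫ / ⟪l, u⟫
  have hw : ⟪l, x - a • u⟫ = 0 := by
    rw [inner_sub_right, real_inner_smul_right, div_mul_cancel₀ _ hpos.ne', sub_self]
  have hsplit : F^[t] x - (lam ^ t * a) • u = F^[t] (x - a • u) := by
    rw [iterate_sub_smul, h.iterate_right, smul_smul, mul_comm a]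
  have ha : |a| ≤ 2 * ‖x‖ / (3 / 4) := by
    rw [abs_div, abs_of_pos hpos]
    refine div_le_div₀ (by positivity) ?_ (by norm_num) h.inner_pos
    exact (abs_real_inner_le_norm _ _).trans (by gcongr; exact h.norm_left)
  -- The constant `7` absorbs `1 + 2 · (8/3) = 19/3`.
  have hnorm : ‖x - a • u‖ ≤ 7 * ‖x‖ := by
    calc ‖x - a • u‖ ≤ ‖x‖ + |a| * ‖u‖ := by
          rw [← Real.norm_eq_abs, ← norm_smul]
          exact norm_sub_le _ _
      _ ≤ ‖x‖ + 2 * ‖x‖ / (3 / 4) * 2 := by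
        gcongr
        exact h.norm_right
      _ ≤ _ := by linarith [norm_nonneg x]
  rw [hsplit]
  refine (h.contract_iterate hlam.le hρ hw t).2.trans ?_
  rw [mul_pow, mul_comm (ρ ^ t), mul_assoc]
  gcongr

/-- The coefficient of `x` along the dominant eigenvector is controlled by the inner product of `x`
with a power of the adjoint applied to `v`. -/
theorem le_abs_coeff (h : Dominant F v lam ρ u l) (hlam : 0 < lam) (hρ : 0 ≤ ρ) {x : V}
    (hv : ‖v‖ = 1) {s : ℝ} (hs : 0 ≤ s) (k : ℕ)
    (hx : s * ‖F.adjoint^[k] v‖ ≤ |⟪F.adjoint^[k] v, x⟫|) :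
    s / 2 - ρ ^ k * (7 * ‖x‖) ≤ |⟪l, x⟫ / ⟪l, u⟫| := by
  have hadj := inner_adjoint_iterate F k v
  set a := ⟪l, x⟫ / ⟪l, u⟫
  -- Here `lam ^ k = ⟪v, F^k u⟫ = ⟪(F*)^k v, u⟫` and `‖u‖ ≤ 2`.
  have h1 : lam ^ k ≤ ‖F.adjoint^[k] v‖ * 2 := by
    have := hadj u
    rw [h.iterate_right, real_inner_smul_right, h.inner_right, mul_one] at this
    rw [← this]
    exact (real_inner_le_norm _ _).trans (by gcongr; exact h.norm_right)
  -- Moving the adjoint back, `F^k x` splits into its component along `u`, whose inner product with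
  -- `v` is `lam ^ k * a`, and a remainder of relative size `ρ ^ k`.
  have h2 : |⟪F.adjoint^[k] v, x⟫| ≤ lam ^ k * |a| + lam ^ k * (ρ ^ k * (7 * ‖x‖)) := by
    have h3 : ⟪F.adjoint^[k] v, x⟫ = lam ^ k * a + ⟪v, F^[k] x - (lam ^ k * a) • u⟫ := by
      rw [hadj, inner_sub_right, real_inner_smul_right, h.inner_right]
      ring
    rw [h3]
    refine (abs_add_le _ _).trans (add_le_add (by rw [abs_mul, abs_of_pos (by positivity)]) ?_)
    refine (abs_real_inner_le_norm _ _).trans ?_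
    rw [hv, one_mul]
    exact h.norm_iterate_sub_le hlam hρ x k
  have h4 : lam ^ k * (s / 2) ≤ lam ^ k * (|a| + ρ ^ k * (7 * ‖x‖)) := by
    calc lam ^ k * (s / 2) = s * (lam ^ k / 2) := by ring
      _ ≤ s * ‖F.adjoint^[k] v‖ := by gcongr; linarith
      _ ≤ _ := by linarith
  linarith [le_of_mul_le_mul_left h4 (by positivity)]

end Dominant

omit [CompleteSpace V] in
-- Rescaling `p` to length `‖q‖` moves it by at most `‖p - q‖`, another `‖p - q‖` leads to `q`, and
-- dividing by `‖q‖ ≥ 1` does not increase the distance. For `p = 0` the left side is `1`.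
theorem norm_normalize_sub_le {p q : V} (hq : 1 ≤ ‖q‖) :
    ‖‖p‖⁻¹ • p - ‖q‖⁻¹ • q‖ ≤ 2 * ‖p - q‖ := by
  have hq0 : 0 < ‖q‖ := by linarith
  rcases eq_or_ne p 0 with rfl | hp
  · simp [norm_smul, hq0.ne']
    linarith
  have hp0 : 0 < ‖p‖ := norm_pos_iff.mpr hp
  have h1 : ‖p‖⁻¹ • p - ‖q‖⁻¹ • q = ‖q‖⁻¹ • (((‖q‖ - ‖p‖) * ‖p‖⁻¹) • p + (p - q)) := by
    rw [sub_mul, mul_inv_cancel₀ hp0.ne', sub_smul, one_smul, smul_add, smul_sub, smul_sub,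
      smul_smul, inv_mul_cancel_left₀ hq0.ne']
    abel
  rw [h1, norm_smul, norm_inv, norm_norm, inv_mul_le_iff₀ hq0]
  calc _ ≤ ‖((‖q‖ - ‖p‖) * ‖p‖⁻¹) • p‖ + ‖p - q‖ := norm_add_le _ _
    _ ≤ ‖p - q‖ + ‖p - q‖ := by
      gcongr
      rw [norm_smul, norm_mul, norm_inv, norm_norm, mul_assoc, inv_mul_cancel₀ hp0.ne', mul_one,
        Real.norm_eq_abs, abs_sub_comm]
      exact abs_norm_sub_norm_le p q
    _ = 1 * (2 * ‖p - q‖) := by ring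
    _ ≤ _ := by gcongr

end RankOne

/-! ### Eigenvalues of the matrix and convergence of the power method -/

section Spectrum

open scoped RealInnerProductSpace

variable {n : ℕ} {M : Matrix (Fin n) (Fin n) ℝ}
  {F : EuclideanSpace ℝ (Fin n) →L[ℝ] EuclideanSpace ℝ (Fin n)}
  {v u l : EuclideanSpace ℝ (Fin n)} {lam ρ : ℝ}

theorem Dominant.one_le_norm_right (h : Dominant F v lam ρ u l) (hv : ‖v‖ = 1) : 1 ≤ ‖u‖ := by
  have := real_inner_le_norm v u
  rwa [h.inner_right, hv, one_mul] at this

theorem signDist_normalize_smul_le {p q : EuclideanSpace ℝ (Fin n)} (hq : 1 ≤ ‖q‖) {c : ℝ}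
    (hc : c ≠ 0) : signDist (‖c • p‖⁻¹ • c • p) (‖q‖⁻¹ • q) ≤ 2 * ‖p - q‖ := by
  have h := norm_normalize_sub_le (p := p) hq
  rw [signDist, norm_smul, mul_inv, smul_smul, mul_right_comm]
  rcases lt_or_gt_of_ne hc with hc | hc
  · refine (min_le_right _ _).trans ?_
    rw [Real.norm_of_nonpos hc.le, inv_neg, neg_mul, inv_mul_cancel₀ hc.ne, neg_one_mul, neg_smul,
      neg_add_eq_sub, norm_sub_rev]
    exact h
  · refine (min_le_left _ _).trans ?_
    rwa [Real.norm_of_nonneg hc.le, inv_mul_cancel₀ hc.ne', one_mul]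

theorem Dominant.signDist_iterate_le (h : Dominant F v lam ρ u l) (hlam : 0 < lam) (hρ : 0 ≤ ρ)
    (hv : ‖v‖ = 1) {x : EuclideanSpace ℝ (Fin n)} {α : ℝ} (hα : 0 < α)
    (hx : α ≤ |⟪l, x⟫ / ⟪l, u⟫|) (t : ℕ) :
    signDist (‖F^[t] x‖⁻¹ • F^[t] x) (‖u‖⁻¹ • u) ≤ 14 * ‖x‖ / α * ρ ^ t := by
  have hc : lam ^ t * (⟪l, x⟫ / ⟪l, u⟫) ≠ 0 :=
    mul_ne_zero (by positivity) (abs_pos.mp (hα.trans_le hx))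
  have hle := h.norm_iterate_sub_le hlam hρ x t
  set a := ⟪l, x⟫ / ⟪l, u⟫
  have hy : F^[t] x = (lam ^ t * a) • (lam ^ t * a)⁻¹ • F^[t] x := by rw [smul_inv_smul₀ hc]
  have hr : ‖(lam ^ t * a)⁻¹ • F^[t] x - u‖ ≤ ρ ^ t * (7 * ‖x‖) / α := by
    have h1 : (lam ^ t * a)⁻¹ • F^[t] x - u =
        (lam ^ t * a)⁻¹ • (F^[t] x - (lam ^ t * a) • u) := by
      rw [smul_sub, inv_smul_smul₀ hc]
    rw [h1, norm_smul, norm_inv, Real.norm_eq_abs, abs_mul, abs_of_pos (by positivity : 0 < lam ^ t),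
      inv_mul_le_iff₀ (mul_pos (by positivity) (hα.trans_le hx))]
    refine hle.trans ?_
    rw [mul_assoc (lam ^ t)]
    refine mul_le_mul_of_nonneg_left ?_ (by positivity)
    rw [← mul_div_assoc, le_div_iff₀ hα, mul_comm]
    gcongr
  rw [hy]
  refine (signDist_normalize_smul_le (h.one_le_norm_right hv) hc).trans ?_
  calc _ ≤ 2 * (ρ ^ t * (7 * ‖x‖) / α) := by gcongr
    _ = _ := by ring

/-- Normalizing a zero vector would give zero, so this is what makes the output a unit vector. -/
theorem Dominant.iterate_ne_zero (h : Dominant F v lam ρ u l) (hlam : 0 < lam) (hρ : 0 ≤ ρ)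
    (hv : ‖v‖ = 1) {x : EuclideanSpace ℝ (Fin n)} {α : ℝ} (hx : α ≤ |⟪l, x⟫ / ⟪l, u⟫|) (t : ℕ)
    (ht : ρ ^ t * (7 * ‖x‖) < α) : F^[t] x ≠ 0 := by
  intro h0
  have hle := h.norm_iterate_sub_le hlam hρ x t
  rw [h0, zero_sub, norm_neg, norm_smul, norm_mul, Real.norm_of_nonneg (by positivity),
    Real.norm_eq_abs, mul_assoc] at hle
  have h1 := le_of_mul_le_mul_left hle (by positivity)
  have h2 : |⟪l, x⟫ / ⟪l, u⟫| ≤ |⟪l, x⟫ / ⟪l, u⟫| * ‖u‖ :=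
    le_mul_of_one_le_right (abs_nonneg _) (h.one_le_norm_right hv)
  linarith

/-- Split a complex eigenvector as `x + i y`. If `z ≠ lam`, then `x` and `y` are both orthogonal to
the left eigenvector `l`, so `F` contracts both, while `‖F x‖² + ‖F y‖² = |z|² (‖x‖² + ‖y‖²)`. -/
theorem Dominant.eq_or_norm_le_of_mem_eigenvalues (h : Dominant F v lam ρ u l) (hlam : 0 < lam)
    (hρ : 0 ≤ ρ) (hF : ∀ x, F x = M.toEuclideanLin x) {z : ℂ} (hz : z ∈ eigenvalues M) :
    z = lam ∨ ‖z‖ ≤ ρ * lam := by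
  rw [eigenvalues, Polynomial.mem_roots', Polynomial.IsRoot.def, Matrix.eval_charpoly,
    ← Matrix.exists_mulVec_eq_zero_iff] at hz
  obtain ⟨-, w, hw0, hw⟩ := hz
  rw [Matrix.sub_mulVec, sub_eq_zero] at hw
  have hw' (i : Fin n) : z * w i = ∑ j, (M i j : ℂ) * w j := by
    have := congrFun hw i
    simpa [Matrix.scalar_apply, Matrix.mulVec, dotProduct, Matrix.diagonal_apply] using this
  set x : EuclideanSpace ℝ (Fin n) := WithLp.toLp 2 fun i => (w i).re with hx
  set y : EuclideanSpace ℝ (Fin n) := WithLp.toLp 2 fun i => (w i).im with hy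
  have hFx : F x = z.re • x - z.im • y := by
    ext i
    have := congrArg Complex.re (hw' i)
    rw [hF]
    simpa [Matrix.toLpLin_apply, Matrix.mulVec, dotProduct, hx, hy] using this.symm
  have hFy : F y = z.im • x + z.re • y := by
    ext i
    have := congrArg Complex.im (hw' i)
    rw [hF]
    simp [Matrix.toLpLin_apply, Matrix.mulVec, dotProduct, hx, hy] at this ⊢
    linarith
  have hxy : 0 < ‖x‖ ^ 2 + ‖y‖ ^ 2 := by
    by_contra! hle
    have hx0 : x = 0 := by
      rw [← norm_eq_zero, ← sq_eq_zero_iff]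
      nlinarith [sq_nonneg ‖x‖, sq_nonneg ‖y‖]
    have hy0 : y = 0 := by
      rw [← norm_eq_zero, ← sq_eq_zero_iff]
      nlinarith [sq_nonneg ‖x‖, sq_nonneg ‖y‖]
    refine hw0 (funext fun i => Complex.ext ?_ ?_)
    · simpa [hx] using congrArg (fun e : EuclideanSpace ℝ (Fin n) => e i) hx0
    · simpa [hy] using congrArg (fun e : EuclideanSpace ℝ (Fin n) => e i) hy0
  by_cases hzl : z = lam
  · exact .inl hzl
  right
  have hp := h.inner_left_map x
  have hq := h.inner_left_map y
  rw [hFx, inner_sub_right, real_inner_smul_right, real_inner_smul_right] at hp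
  rw [hFy, inner_add_right, real_inner_smul_right, real_inner_smul_right] at hq
  have hd : 0 < (lam - z.re) ^ 2 + z.im ^ 2 := by
    by_contra! hle
    refine hzl (Complex.ext ?_ ?_)
    · simp only [Complex.ofReal_re]
      nlinarith [sq_nonneg (lam - z.re), sq_nonneg z.im]
    · simp only [Complex.ofReal_im]
      nlinarith [sq_nonneg (lam - z.re), sq_nonneg z.im]
  -- The pairings with `l` solve a homogeneous 2 × 2 system with determinant `(lam - re z)² + (im
  -- z)² > 0`.
  have hlx : ⟪l, x⟫ = 0 := by
    have : ((lam - z.re) ^ 2 + z.im ^ 2) * ⟪l, x⟫ = 0 := by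
      linear_combination (z.re - lam) * hp + z.im * hq
    exact (mul_eq_zero.mp this).resolve_left hd.ne'
  have hly : ⟪l, y⟫ = 0 := by
    have : ((lam - z.re) ^ 2 + z.im ^ 2) * ⟪l, y⟫ = 0 := by
      linear_combination (z.re - lam) * hq - z.im * hp
    exact (mul_eq_zero.mp this).resolve_left hd.ne'
  have h1 : ‖F x‖ ^ 2 + ‖F y‖ ^ 2 = ‖z‖ ^ 2 * (‖x‖ ^ 2 + ‖y‖ ^ 2) := by
    rw [hFx, hFy, norm_sub_sq_real, norm_add_sq_real, Complex.sq_norm, Complex.normSq_apply]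
    simp only [norm_smul, real_inner_smul_left, real_inner_smul_right, mul_pow, Real.norm_eq_abs,
      sq_abs]
    ring
  have h2 : ‖F x‖ ^ 2 + ‖F y‖ ^ 2 ≤ (ρ * lam) ^ 2 * (‖x‖ ^ 2 + ‖y‖ ^ 2) := by
    have hx := h.contract x hlx
    have hy := h.contract y hly
    calc _ ≤ (ρ * lam * ‖x‖) ^ 2 + (ρ * lam * ‖y‖) ^ 2 := by gcongr
      _ = _ := by ring
  rw [h1] at h2
  exact le_of_sq_le_sq (le_of_mul_le_mul_right h2 hxy) (by positivity)

theorem charpoly_toEuclideanLin (M : Matrix (Fin n) (Fin n) ℝ) :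
    M.toEuclideanLin.charpoly = M.charpoly := by
  rw [← Matrix.charpoly_toLin M (PiLp.basisFun 2 ℝ (Fin n))]
  exact congrArg LinearMap.charpoly (congrFun (congrArg _ (Matrix.toLpLin_eq_toLin 2 2)) M)

theorem Dominant.mem_eigenvalues (h : Dominant F v lam ρ u l) (hv : ‖v‖ = 1)
    (hF : ∀ x, F x = M.toEuclideanLin x) : (lam : ℂ) ∈ eigenvalues M := by
  rw [eigenvalues, Polynomial.mem_roots (Matrix.charpoly_monic _).ne_zero]
  have hroot : Polynomial.IsRoot M.charpoly lam := by
    rw [← charpoly_toEuclideanLin, ← Module.End.hasEigenvalue_iff_isRoot_charpoly]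
    refine Module.End.hasEigenvalue_of_hasEigenvector (x := u)
      ⟨Module.End.mem_eigenspace_iff.mpr ?_, ?_⟩
    · rw [← hF, h.map_right]
    · exact norm_pos_iff.mp (by linarith [h.one_le_norm_right hv])
  have := hroot.map (f := algebraMap ℝ ℂ)
  rwa [← Matrix.charpoly_map] at this

/-- The algebraic multiplicity is the dimension of the generalized eigenspace. The map `G = F - lam`
sends everything into the hyperplane orthogonal to `l` and is injective on it, as `ρ < 1`. So a
generalized eigenvector is already in the kernel of `G`, and that kernel is spanned by `u`. -/
theorem Dominant.count_eigenvalues_le (h : Dominant F v lam ρ u l) (hlam : 0 < lam)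
    (hρ1 : ρ < 1) (hF : ∀ x, F x = M.toEuclideanLin x) :
    (eigenvalues M).count (lam : ℂ) ≤ 1 := by
  have hmult : (eigenvalues M).count (lam : ℂ) = M.charpoly.rootMultiplicity lam := by
    rw [eigenvalues, Polynomial.count_roots, Matrix.charpoly_map]
    exact (Polynomial.eq_rootMultiplicity_map (algebraMap ℝ ℂ).injective lam).symm
  rw [hmult, ← charpoly_toEuclideanLin, ← LinearMap.finrank_maxGenEigenspace_eq]
  have hker (w : EuclideanSpace ℝ (Fin n)) (hw : ⟪l, w⟫ = 0) (hFw : F w = lam • w) : w = 0 := by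
    have h1 := h.contract w hw
    rw [hFw, norm_smul, Real.norm_of_nonneg hlam.le] at h1
    by_contra hw0
    have : 0 < lam * ‖w‖ := mul_pos hlam (norm_pos_iff.mpr hw0)
    nlinarith
  set G : Module.End ℝ (EuclideanSpace ℝ (Fin n)) := M.toEuclideanLin - lam • 1 with hG
  have hGF (w) : G w = F w - lam • w := by simp [hG, hF]
  have hpow (k : ℕ) (w : EuclideanSpace ℝ (Fin n)) (hw : ⟪l, w⟫ = 0) (hk : (G ^ k) w = 0) :
      w = 0 := by
    induction k generalizing w with
    | zero => simpa using hk
    | succ k ih =>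
      have hl : ⟪l, G w⟫ = 0 := by
        rw [hGF, inner_sub_right, h.inner_left_map, hw, real_inner_smul_right, hw]
        simp
      have := ih (G w) hl (by rwa [pow_succ] at hk)
      rw [hGF, sub_eq_zero] at this
      exact hker w hw this
  have hle : Module.End.maxGenEigenspace M.toEuclideanLin lam ≤ Submodule.span ℝ {u} := by
    intro x hx
    rw [Module.End.mem_maxGenEigenspace] at hx
    obtain ⟨k, hk⟩ := hx
    have hGx : G x = 0 := by
      refine hpow k _ ?_ ?_
      · rw [hGF, inner_sub_right, h.inner_left_map, real_inner_smul_right, sub_self]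
      · change (G ^ k * G) x = 0
        rw [← pow_succ, pow_succ', Module.End.mul_apply, hk, map_zero]
    rw [hGF, sub_eq_zero] at hGx
    have hpos : 0 < ⟪l, u⟫ := by linarith [h.inner_pos]
    have := hker (x - (⟪l, x⟫ / ⟪l, u⟫) • u) ?_ ?_
    · rw [sub_eq_zero] at this
      exact Submodule.mem_span_singleton.mpr ⟨_, this.symm⟩
    · rw [inner_sub_right, real_inner_smul_right, div_mul_cancel₀ _ hpos.ne', sub_self]
    · rw [map_sub, map_smul, hGx, h.map_right, smul_sub, smul_comm]
  exact (Submodule.finrank_mono hle).trans ((finrank_span_le_card {u}).trans (by simp))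

theorem Dominant.spectralGapRatioGE (h : Dominant F v lam ρ u l) (hv : ‖v‖ = 1) (hlam : 0 < lam)
    (hρ : 0 ≤ ρ) (hρ1 : ρ < 1) (hF : ∀ x, F x = M.toEuclideanLin x) {r : ℝ} (hr : 0 ≤ r)
    (hrρ : r * ρ ≤ 1) : SpectralGapRatioGE M lam r := by
  refine ⟨h.mem_eigenvalues hv hF, fun z hz => ?_⟩
  obtain rfl | hz' := h.eq_or_norm_le_of_mem_eigenvalues hlam hρ hF (Multiset.mem_of_mem_erase hz)
  -- A copy of `lam` left after the erasure would make its multiplicity at least two.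
  · have h1 := Multiset.count_pos.mpr hz
    rw [Multiset.count_erase_self] at h1
    have := h.count_eigenvalues_le hlam hρ1 hF
    omega
  · calc r * ‖z‖ ≤ r * (ρ * lam) := by gcongr
      _ = r * ρ * lam := by ring
      _ ≤ 1 * lam := by gcongr
      _ = lam := one_mul _

theorem Dominant.isTopEigenvector (h : Dominant F v lam ρ u l) (hv : ‖v‖ = 1) (hlam : 0 < lam)
    (hρ : 0 ≤ ρ) (hρ1 : ρ < 1) (hF : ∀ x, F x = M.toEuclideanLin x) :
    IsTopEigenvector M lam (‖u‖⁻¹ • u) := by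
  have hu : ‖u‖ ≠ 0 := by linarith [h.one_le_norm_right hv]
  refine ⟨by rw [norm_smul, norm_inv, norm_norm, inv_mul_cancel₀ hu], ?_, hlam, fun z hz => ?_⟩
  · rw [map_smul, ← hF, h.map_right, smul_comm]
  · obtain rfl | hz' := h.eq_or_norm_le_of_mem_eigenvalues hlam hρ hF hz
    · simp [abs_of_pos hlam]
    · exact hz'.trans (mul_le_of_le_one_left hlam.le hρ1.le)

end Spectrum

/-! ### Tails, second moments and anticoncentration of Gaussian linear forms -/

section Gaussian

variable {ι : Type} [Fintype ι]

instance : IsProbabilityMeasure (stdGaussianPi ι) := by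
  unfold stdGaussianPi
  infer_instance

theorem map_sum_mul_stdGaussianPi (a : ι → ℝ) :
    (stdGaussianPi ι).map (fun x => ∑ i, a i * x i) =
      gaussianReal 0 (∑ i, a i ^ 2).toNNReal := by
  set L : StrongDual ℝ (EuclideanSpace ℝ ι) := innerSL ℝ (WithLp.toLp 2 a)
  have h1 : (fun x : ι → ℝ => ∑ i, a i * x i) = L ∘ WithLp.toLp 2 := by
    ext x
    simp [L, PiLp.inner_apply, mul_comm]
  rw [h1, ← Measure.map_map (by fun_prop) (by fun_prop), stdGaussianPi, map_pi_eq_stdGaussian,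
    IsGaussian.map_eq_gaussianReal, integral_strongDual_stdGaussian, variance_dual_stdGaussian]
  congr 2
  rw [innerSL_apply_norm, EuclideanSpace.real_norm_sq_eq]

theorem measurable_sum_mul (a : ι → ℝ) : Measurable fun x : ι → ℝ => ∑ i, a i * x i := by
  fun_prop

theorem stdGaussianPi_le_sum_mul_le {a : ι → ℝ} {σ t : ℝ} (ha : ∑ i, a i ^ 2 ≤ σ) (ht : 0 ≤ t) :
    stdGaussianPi ι {x | t ≤ ∑ i, a i * x i} ≤ ENNReal.ofReal (Real.exp (-t ^ 2 / (2 * σ))) := by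
  have h0 : 0 ≤ ∑ i, a i ^ 2 := Finset.sum_nonneg fun i _ => sq_nonneg _
  have hmap := map_sum_mul_stdGaussianPi a
  have hsub : HasSubgaussianMGF (fun x : ι → ℝ => ∑ i, a i * x i) σ.toNNReal (stdGaussianPi ι) := by
    constructor
    · intro s
      have := integrable_exp_mul_gaussianReal (μ := 0) (v := (∑ i, a i ^ 2).toNNReal) s
      rw [← hmap, integrable_map_measure (by fun_prop) (measurable_sum_mul a).aemeasurable] at this
      exact this
    · intro s
      rw [mgf_gaussianReal hmap, Real.coe_toNNReal _ h0, Real.coe_toNNReal _ (h0.trans ha)]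
      gcongr
      linarith [mul_le_mul_of_nonneg_right ha (sq_nonneg s)]
  have := hsub.measure_ge_le ht
  rw [Real.coe_toNNReal _ (h0.trans ha)] at this
  rw [← ofReal_measureReal]
  exact ENNReal.ofReal_le_ofReal this

theorem lintegral_sq_sum_mul (a : ι → ℝ) :
    ∫⁻ x, ENNReal.ofReal ((∑ i, a i * x i) ^ 2) ∂stdGaussianPi ι =
      ENNReal.ofReal (∑ i, a i ^ 2) := by
  have h0 : 0 ≤ ∑ i, a i ^ 2 := Finset.sum_nonneg fun i _ => sq_nonneg _
  have h1 := lintegral_map (μ := stdGaussianPi ι) (f := fun y : ℝ => ENNReal.ofReal (y ^ 2))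
    (by fun_prop) (measurable_sum_mul a)
  rw [← h1, map_sum_mul_stdGaussianPi]
  set γ := gaussianReal 0 (∑ i, a i ^ 2).toNNReal
  have hint : Integrable (fun y : ℝ => y ^ 2) γ := (memLp_id_gaussianReal' 2 (by simp)).integrable_sq
  rw [← ofReal_integral_eq_lintegral_ofReal hint (ae_of_all _ fun y => sq_nonneg y)]
  have h2 := variance_of_integral_eq_zero (μ := γ) (X := fun y => y) (by fun_prop)
    integral_id_gaussianReal
  rw [variance_fun_id_gaussianReal, Real.coe_toNNReal _ h0] at h2
  rw [h2]

/-- Markov's inequality for the second moment. It is enough for the trace vector, for its component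
along `v` and for the norm of `g`. -/
theorem stdGaussianPi_le_sum_sq_le {κ : Type*} [Fintype κ] (a : κ → ι → ℝ) {c : ℝ} (hc : 0 < c) :
    stdGaussianPi ι {x | c ≤ ∑ k, (∑ i, a k i * x i) ^ 2} ≤
      ENNReal.ofReal ((∑ k, ∑ i, a k i ^ 2) / c) := by
  have h1 : {x : ι → ℝ | c ≤ ∑ k, (∑ i, a k i * x i) ^ 2} =
      {x | ENNReal.ofReal c ≤ ∑ k, ENNReal.ofReal ((∑ i, a k i * x i) ^ 2)} := by
    ext x
    rw [Set.mem_ofPred_eq, Set.mem_ofPred_eq, ← ENNReal.ofReal_sum_of_nonneg fun _ _ => sq_nonneg _,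
      ENNReal.ofReal_le_ofReal_iff (Finset.sum_nonneg fun _ _ => sq_nonneg _)]
  rw [h1]
  refine (meas_ge_le_lintegral_div (Measurable.aemeasurable (by fun_prop)) (by simpa using hc) (by simp)).trans ?_
  rw [lintegral_finsetSum _ (fun k _ => by fun_prop)]
  simp_rw [lintegral_sq_sum_mul]
  rw [← ENNReal.ofReal_sum_of_nonneg fun k _ => Finset.sum_nonneg fun i _ => sq_nonneg _,
    ENNReal.ofReal_div_of_pos hc]

/-- The density is at most `1 / √(2 π v) ≤ 1 / (2 √v)` and the interval has length `2 s √v`. -/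
theorem gaussianReal_abs_lt_le {v : ℝ} (hv : 0 < v) (s : ℝ) :
    gaussianReal 0 v.toNNReal {y | |y| < s * √v} ≤ ENNReal.ofReal s := by
  have hv' : v.toNNReal ≠ 0 := by simpa using hv
  rw [gaussianReal_apply 0 hv']
  have hpdf (y : ℝ) : gaussianPDF 0 v.toNNReal y ≤ ENNReal.ofReal (1 / (2 * √v)) := by
    refine ENNReal.ofReal_le_ofReal ?_
    rw [gaussianPDFReal, Real.coe_toNNReal _ hv.le]
    have h1 : Real.exp (-(y - 0) ^ 2 / (2 * v)) ≤ 1 := by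
      rw [Real.exp_le_one_iff]
      exact div_nonpos_of_nonpos_of_nonneg (by nlinarith [sq_nonneg (y - 0)]) (by positivity)
    have h2 : 2 * √v ≤ √(2 * Real.pi * v) := by
      apply Real.le_sqrt_of_sq_le
      rw [mul_pow, Real.sq_sqrt hv.le]
      nlinarith [Real.pi_gt_three]
    calc _ ≤ (√(2 * Real.pi * v))⁻¹ * 1 := by gcongr
      _ ≤ (2 * √v)⁻¹ * 1 := by gcongr
      _ = _ := by ring
  have hset : {y : ℝ | |y| < s * √v} = Set.Ioo (-(s * √v)) (s * √v) := by
    ext y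
    simp [abs_lt]
  calc _ ≤ ∫⁻ _ in {y : ℝ | |y| < s * √v}, ENNReal.ofReal (1 / (2 * √v)) :=
        lintegral_mono fun y => hpdf y
    _ = ENNReal.ofReal (1 / (2 * √v)) * ENNReal.ofReal (s * √v + s * √v) := by
      rw [lintegral_const, hset, Measure.restrict_apply_univ, Real.volume_Ioo, sub_neg_eq_add]
    _ = ENNReal.ofReal s := by
      rw [← ENNReal.ofReal_mul (by positivity)]
      congr 1
      have : √v ≠ 0 := by positivity
      field_simp
      ring

theorem stdGaussianPi_abs_sum_mul_lt_le (a : ι → ℝ) (s : ℝ) :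
    stdGaussianPi ι {x | |∑ i, a i * x i| < s * √(∑ i, a i ^ 2)} ≤ ENNReal.ofReal s := by
  have h0 : 0 ≤ ∑ i, a i ^ 2 := Finset.sum_nonneg fun i _ => sq_nonneg _
  -- For `a = 0` the event is empty because its inequality is strict.
  rcases h0.eq_or_lt with h0 | h0
  · rw [← h0]
    have h1 (x : ι → ℝ) : ¬ |∑ i, a i * x i| < 0 := (abs_nonneg _).not_gt
    simp [h1]
  · rw [← Set.preimage_ofPred_eq (p := fun y => |y| < s * √(∑ i, a i ^ 2))
      (f := fun x : ι → ℝ => ∑ i, a i * x i), ← Measure.map_apply (measurable_sum_mul a)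
      (measurableSet_lt (by fun_prop) (by fun_prop)), map_sum_mul_stdGaussianPi]
    exact gaussianReal_abs_lt_le h0 s

/-- A Gaussian vector independent of a random vector `q` is not almost orthogonal to `q`. -/
theorem prod_stdGaussianPi_abs_sum_mul_lt_le {Ω : Type*} [MeasurableSpace Ω] (μ : Measure Ω)
    [IsProbabilityMeasure μ] {q : Ω → ι → ℝ} (hq : Measurable q) (s : ℝ) :
    (μ.prod (stdGaussianPi ι))
      {ω | |∑ i, q ω.1 i * ω.2 i| < s * √(∑ i, q ω.1 i ^ 2)} ≤ ENNReal.ofReal s := by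
  have hq' (i : ι) : Measurable fun ω : Ω × (ι → ℝ) => q ω.1 i :=
    (measurable_pi_apply i).comp (hq.comp measurable_fst)
  rw [Measure.prod_apply (measurableSet_lt (by fun_prop) (by fun_prop))]
  calc _ ≤ ∫⁻ _, ENNReal.ofReal s ∂μ :=
        lintegral_mono fun ω => stdGaussianPi_abs_sum_mul_lt_le (q ω) s
    _ = _ := by simp

end Gaussian

/-! ### The injective norm of a Gaussian tensor -/

section InjectiveNorm

variable {n : ℕ}

/-- The trilinear form of a tensor. -/
noncomputable def tri (A : Tensor n) (x y z : EuclideanSpace ℝ (Fin n)) : ℝ :=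
  ∑ p, x p.1 * y p.2.1 * z p.2.2 * A p

variable (A : Tensor n) (x x' y y' z z' : EuclideanSpace ℝ (Fin n)) (c : ℝ)

theorem tri_sub_left : tri A (x - x') y z = tri A x y z - tri A x' y z := by
  simp [tri, sub_mul]

theorem tri_sub_middle : tri A x (y - y') z = tri A x y z - tri A x y' z := by
  simp [tri, sub_mul, mul_sub]

theorem tri_sub_right : tri A x y (z - z') = tri A x y z - tri A x y z' := by
  simp [tri, sub_mul, mul_sub]

theorem tri_smul_left : tri A (c • x) y z = c * tri A x y z := by
  simp [tri, Finset.mul_sum, mul_assoc]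

theorem tri_smul_middle : tri A x (c • y) z = c * tri A x y z := by
  simp [tri, Finset.mul_sum, mul_assoc, mul_left_comm]

theorem tri_smul_right : tri A x y (c • z) = c * tri A x y z := by
  simp [tri, Finset.mul_sum, mul_assoc, mul_left_comm]

theorem sum_tri_coeff_sq : ∑ p : Fin n × Fin n × Fin n, (x p.1 * y p.2.1 * z p.2.2) ^ 2 =
    ‖x‖ ^ 2 * ‖y‖ ^ 2 * ‖z‖ ^ 2 := by
  simp only [EuclideanSpace.real_norm_sq_eq, Fintype.sum_prod_type, mul_pow, ← Finset.mul_sum,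
    ← Finset.sum_mul]

/-- The point of the lattice of mesh `1 / (8 * n)` with integer coordinates `q`. -/
noncomputable def latticePoint (q : Fin n → ℤ) : EuclideanSpace ℝ (Fin n) :=
  WithLp.toLp 2 fun i => q i / (8 * n)

open Classical in
/-- A finite net of the unit ball. -/
noncomputable def net (n : ℕ) : Finset (EuclideanSpace ℝ (Fin n)) :=
  {x ∈ (Fintype.piFinset fun _ : Fin n => Finset.Icc (-(8 * n) : ℤ) (8 * n)).image latticePoint |
    ‖x‖ ≤ 9 / 8}

theorem card_net_le (n : ℕ) : (net n).card ≤ (16 * n + 1) ^ n := by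
  classical
  refine (Finset.card_filter_le _ _).trans (Finset.card_image_le.trans ?_)
  rw [Fintype.card_piFinset]
  simp only [Int.card_Icc, Finset.prod_const, Finset.card_univ, Fintype.card_fin]
  refine Nat.pow_le_pow_left ?_ n
  omega

/-- Rounding each coordinate down to the lattice costs at most `1 / (8 n)`, hence at most `1 / (8
√n)` in norm. The net is crude, of size `n^(O(n))`, which accounts for the factor `√(log n)` in the
injective norm. -/
theorem exists_mem_net (hn : 0 < n) {x : EuclideanSpace ℝ (Fin n)} (hx : ‖x‖ ≤ 1) :
    ∃ x' ∈ net n, ‖x - x'‖ ≤ 1 / 8 := by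
  have hn' : (0 : ℝ) < 8 * n := by positivity
  set q : Fin n → ℤ := fun i => ⌊8 * n * x i⌋ with hq
  have hdist : ‖x - latticePoint q‖ ≤ 1 / 8 := by
    rw [EuclideanSpace.norm_eq]
    refine Real.sqrt_le_iff.mpr ⟨by norm_num, ?_⟩
    calc ∑ i, ‖(x - latticePoint q) i‖ ^ 2 ≤ ∑ i : Fin n, (1 / (8 * n) : ℝ) ^ 2 := by
          refine Finset.sum_le_sum fun i _ => ?_
          gcongr
          have h1 : (x - latticePoint q) i = (8 * n * x i - q i) / (8 * n) := by
            simp only [latticePoint, PiLp.sub_apply]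
            field_simp
          rw [h1, norm_div, Real.norm_of_nonneg hn'.le]
          gcongr
          rw [Real.norm_eq_abs, abs_le]
          constructor
          · linarith [Int.floor_le (8 * n * x i)]
          · linarith [Int.lt_floor_add_one (8 * n * x i)]
      _ = (1 / 8) ^ 2 / n := by
        simp
        field_simp
      _ ≤ _ := div_le_self (by norm_num) (by exact_mod_cast hn)
  refine ⟨latticePoint q, ?_, hdist⟩
  rw [net, Finset.mem_filter, Finset.mem_image]
  refine ⟨⟨q, ?_, rfl⟩, ?_⟩
  · rw [Fintype.mem_piFinset]
    intro i
    have hxi : |x i| ≤ 1 := by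
      rw [← Real.norm_eq_abs]
      exact (PiLp.norm_apply_le x i).trans hx
    rw [abs_le] at hxi
    rw [Finset.mem_Icc, hq]
    constructor
    · rw [Int.le_floor]
      push_cast
      nlinarith
    · rw [Int.floor_le_iff]
      push_cast
      nlinarith
  · have := norm_sub_norm_le (latticePoint q) x
    rw [norm_sub_rev] at this
    linarith

/-- Let `L` be the maximum over unit balls. Replacing the maximizing vectors by net points one at a
time gives `L ≤ t + (L/8) (1 + 9/8 + 81/64)`, and the factor of `L` is below `1/2`. A one-sided
hypothesis suffices because `x` can be negated. -/
theorem tri_le_of_net (hn : 0 < n) {A : Tensor n} {t : ℝ} (ht : 0 ≤ t)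
    (hA : ∀ x ∈ net n, ∀ y ∈ net n, ∀ z ∈ net n, tri A x y z ≤ t)
    (x y z : EuclideanSpace ℝ (Fin n)) : |tri A x y z| ≤ 2 * t * ‖x‖ * ‖y‖ * ‖z‖ := by
  set B : Set (EuclideanSpace ℝ (Fin n)) := Metric.closedBall 0 1
  have hB : IsCompact B := isCompact_closedBall _ _
  have h0 : (0 : EuclideanSpace ℝ (Fin n)) ∈ B := Metric.mem_closedBall_self zero_le_one
  obtain ⟨⟨a, b, c⟩, ⟨ha, hb, hc⟩, hmax⟩ := (hB.prod (hB.prod hB)).exists_isMaxOn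
    ⟨(0, 0, 0), h0, h0, h0⟩ (f := fun p => tri A p.1 p.2.1 p.2.2)
    (by unfold tri; fun_prop)
  set L := tri A a b c
  have hmax' (x y z) (hx : x ∈ B) (hy : y ∈ B) (hz : z ∈ B) : tri A x y z ≤ L :=
    hmax (show (x, y, z) ∈ B ×ˢ B ×ˢ B from ⟨hx, hy, hz⟩)
  have hL0 : 0 ≤ L := by simpa [tri] using hmax' 0 0 0 h0 h0 h0
  have hL (x y z : EuclideanSpace ℝ (Fin n)) : tri A x y z ≤ L * ‖x‖ * ‖y‖ * ‖z‖ := by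
    rcases eq_or_ne x 0 with rfl | hx
    · simp [tri]
    rcases eq_or_ne y 0 with rfl | hy
    · simp [tri]
    rcases eq_or_ne z 0 with rfl | hz
    · simp [tri]
    have h1 (w : EuclideanSpace ℝ (Fin n)) (hw : w ≠ 0) : ‖w‖⁻¹ • w ∈ B := by
      rw [Metric.mem_closedBall, dist_zero_right, norm_smul, norm_inv, norm_norm,
        inv_mul_cancel₀ (norm_ne_zero_iff.mpr hw)]
    have h2 := hmax' _ _ _ (h1 x hx) (h1 y hy) (h1 z hz)
    rw [tri_smul_left, tri_smul_middle, tri_smul_right, inv_mul_le_iff₀ (norm_pos_iff.mpr hx),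
      inv_mul_le_iff₀ (norm_pos_iff.mpr hy), inv_mul_le_iff₀ (norm_pos_iff.mpr hz)] at h2
    linarith
  have hLt : L ≤ 2 * t := by
    have hB1 {w : EuclideanSpace ℝ (Fin n)} (hw : w ∈ B) : ‖w‖ ≤ 1 := by
      simpa [B] using hw
    have hnet {w : EuclideanSpace ℝ (Fin n)} (hw : w ∈ net n) : ‖w‖ ≤ 9 / 8 :=
      (Finset.mem_filter.mp hw).2
    obtain ⟨a', ha', haa⟩ := exists_mem_net hn (hB1 ha)
    obtain ⟨b', hb', hbb⟩ := exists_mem_net hn (hB1 hb)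
    obtain ⟨c', hc', hcc⟩ := exists_mem_net hn (hB1 hc)
    have h1 : L = tri A a' b' c' + tri A (a - a') b c + tri A a' (b - b') c +
        tri A a' b' (c - c') := by
      rw [tri_sub_left, tri_sub_middle, tri_sub_right]
      ring
    have h2 : tri A (a - a') b c ≤ L * (1 / 8) * 1 * 1 :=
      (hL _ _ _).trans (by gcongr <;> exact hB1 ‹_›)
    have h3 : tri A a' (b - b') c ≤ L * (9 / 8) * (1 / 8) * 1 :=
      (hL _ _ _).trans (by gcongr; exacts [hnet ha', hB1 hc])
    have h4 : tri A a' b' (c - c') ≤ L * (9 / 8) * (9 / 8) * (1 / 8) :=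
      (hL _ _ _).trans (by gcongr; exacts [hnet ha', hnet hb'])
    linarith [hA a' ha' b' hb' c' hc']
  have hle (x : EuclideanSpace ℝ (Fin n)) : tri A x y z ≤ 2 * t * ‖x‖ * ‖y‖ * ‖z‖ :=
    (hL x y z).trans (by gcongr)
  refine abs_le.mpr ⟨?_, hle x⟩
  have h1 := hle ((-1 : ℝ) • x)
  rw [tri_smul_left, norm_smul, norm_neg, norm_one, one_mul] at h1
  linarith

/-- The injective norm of a Gaussian tensor is at most of order `√(n * log n)`. -/
theorem stdGaussianPi_exists_tri_gt_le (hn : 17 ≤ n) :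
    stdGaussianPi (Fin n × Fin n × Fin n)
      {A | ∃ x y z, 16 * √(n * Real.log n) * ‖x‖ * ‖y‖ * ‖z‖ < |tri A x y z|} ≤
        ENNReal.ofReal (1 / n) := by
  have hn0 : 0 < n := by omega
  have hn0' : (0 : ℝ) < n := by positivity
  have hn17 : (17 : ℝ) ≤ n := by exact_mod_cast hn
  have hlog : 0 ≤ Real.log n := Real.log_nonneg (by linarith)
  set t := 8 * √(n * Real.log n) with ht
  have ht0 : 0 ≤ t := by positivity
  have hsub : {A | ∃ x y z, 16 * √(n * Real.log n) * ‖x‖ * ‖y‖ * ‖z‖ < |tri A x y z|} ⊆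
      ⋃ p ∈ net n ×ˢ net n ×ˢ net n,
        {A : Tensor n | t ≤ ∑ i, p.1 i.1 * p.2.1 i.2.1 * p.2.2 i.2.2 * A i} := by
    rintro A ⟨x, y, z, hxyz⟩
    by_contra hA
    simp only [Set.mem_iUnion, Set.mem_ofPred_eq, exists_prop, Finset.mem_product,
      not_exists, not_and, not_le] at hA
    refine hxyz.not_ge ?_
    have := tri_le_of_net hn0 ht0 (fun x hx y hy z hz => (hA (x, y, z) ⟨hx, hy, hz⟩).le) x y z
    rwa [show 2 * t = 16 * √(n * Real.log n) by rw [ht]; ring] at this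
  have hnet {w : EuclideanSpace ℝ (Fin n)} (hw : w ∈ net n) : ‖w‖ ≤ 9 / 8 :=
    (Finset.mem_filter.mp hw).2
  have hone (p) (hp : p ∈ net n ×ˢ net n ×ˢ net n) :
      stdGaussianPi (Fin n × Fin n × Fin n)
        {A : Tensor n | t ≤ ∑ i, p.1 i.1 * p.2.1 i.2.1 * p.2.2 i.2.2 * A i} ≤
        ENNReal.ofReal (Real.exp (-t ^ 2 / (2 * 3))) := by
    simp only [Finset.mem_product] at hp
    refine stdGaussianPi_le_sum_mul_le ?_ ht0
    rw [sum_tri_coeff_sq]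
    calc _ ≤ ((9 : ℝ) / 8) ^ 2 * (9 / 8) ^ 2 * (9 / 8) ^ 2 := by
          gcongr
          exacts [hnet hp.1, hnet hp.2.1, hnet hp.2.2]
      _ ≤ 3 := by norm_num
  refine (measure_mono hsub).trans ((measure_biUnion_finset_le _ _).trans
    ((Finset.sum_le_sum hone).trans ?_))
  rw [Finset.sum_const, nsmul_eq_mul, ← ENNReal.ofReal_natCast, ← ENNReal.ofReal_mul (by positivity)]
  refine ENNReal.ofReal_le_ofReal ?_
  -- For `n ≥ 17` the net has at most `(16 n + 1)^n ≤ n^(2n)` points, so the triples number at most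
  -- `exp(6 n log n)`. The exponent `t² / 6 = (64/6) n log n` outweighs this.
  have hcard : ((net n ×ˢ net n ×ˢ net n).card : ℝ) ≤ Real.exp (6 * (n * Real.log n)) := by
    rw [Finset.card_product, Finset.card_product]
    have h1 : ((net n).card : ℝ) ≤ Real.exp (2 * (n * Real.log n)) := by
      calc ((net n).card : ℝ) ≤ ((16 * n + 1 : ℕ) : ℝ) ^ n := by exact_mod_cast card_net_le n
        _ ≤ ((n : ℝ) ^ 2) ^ n := by
          gcongr
          push_cast
          nlinarith
        _ = _ := by
          rw [show 2 * (n * Real.log n) = n * (2 * Real.log n) by ring, Real.exp_nat_mul,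
            show 2 * Real.log n = (2 : ℕ) * Real.log n by norm_num, Real.exp_nat_mul,
            Real.exp_log hn0']
    calc _ ≤ Real.exp (2 * (n * Real.log n)) * (Real.exp (2 * (n * Real.log n)) *
          Real.exp (2 * (n * Real.log n))) := by
          push_cast
          gcongr
      _ = _ := by rw [← Real.exp_add, ← Real.exp_add]; ring_nf
  calc _ ≤ Real.exp (6 * (n * Real.log n)) * Real.exp (-t ^ 2 / (2 * 3)) := by gcongr
    _ = Real.exp (6 * (n * Real.log n) + -t ^ 2 / (2 * 3)) := by rw [Real.exp_add]
    _ ≤ Real.exp (- Real.log n) := by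
      gcongr
      rw [ht, mul_pow, Real.sq_sqrt (by positivity)]
      nlinarith
    _ = 1 / n := by rw [Real.exp_neg, Real.exp_log hn0', one_div]

end InjectiveNorm

/-! ### Signal plus noise decomposition of the trace matrix -/

section Decomposition

open scoped RealInnerProductSpace

variable {n : ℕ}

/-- The traces of the slices. -/
noncomputable def traceVec (A : Tensor n) : EuclideanSpace ℝ (Fin n) :=
  WithLp.toLp 2 fun i => ∑ a, A (i, a, a)

/-- The trace matrix as a continuous linear map. -/
noncomputable def traceMap (T : Tensor n) :
    EuclideanSpace ℝ (Fin n) →L[ℝ] EuclideanSpace ℝ (Fin n) :=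
  (traceMatrix T).toEuclideanLin.toContinuousLinearMap

theorem traceVec_spiked (τ : ℝ) {v : EuclideanSpace ℝ (Fin n)} (hv : ‖v‖ = 1) (A : Tensor n) :
    traceVec (spiked τ v A) = τ • v + traceVec A := by
  have h1 : ∑ a, v a * v a = 1 := by
    simpa [← sq, hv] using (EuclideanSpace.real_norm_sq_eq v).symm
  ext i
  simp only [traceVec, spiked, PiLp.add_apply, PiLp.smul_apply, smul_eq_mul,
    Finset.sum_add_distrib, mul_assoc, ← Finset.mul_sum, h1, mul_one]

theorem traceMap_apply (T : Tensor n) (x : EuclideanSpace ℝ (Fin n)) (j : Fin n) :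
    traceMap T x j = ∑ k, (∑ i, (∑ a, T (i, a, a)) * T (i, j, k)) * x k := by
  simp [traceMap, Matrix.toLpLin_apply, Matrix.mulVec, dotProduct, traceMatrix_apply]

/-- The trace matrix is the tensor contracted in its first mode with its own trace vector, so bounds
on the trilinear form become bounds on the matrix. -/
theorem inner_traceMap (T : Tensor n) (x y : EuclideanSpace ℝ (Fin n)) :
    ⟪y, traceMap T x⟫ = tri T (traceVec T) y x := by
  simp only [tri, PiLp.inner_apply, Fintype.sum_prod_type, traceMap_apply, RCLike.inner_apply,
    conj_trivial]
  rw [Finset.sum_comm]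
  refine Finset.sum_congr rfl fun j _ => ?_
  rw [Finset.sum_comm, Finset.sum_mul]
  refine Finset.sum_congr rfl fun k _ => ?_
  rw [Finset.sum_mul, Finset.sum_mul]
  refine Finset.sum_congr rfl fun i _ => ?_
  rw [traceVec]
  ring

theorem tri_spiked (τ : ℝ) (v : EuclideanSpace ℝ (Fin n)) (A : Tensor n)
    (x y z : EuclideanSpace ℝ (Fin n)) :
    tri (spiked τ v A) x y z = τ * (⟪v, x⟫ * ⟪v, y⟫ * ⟪v, z⟫) + tri A x y z := by
  have h1 : ∑ p : Fin n × Fin n × Fin n, τ * ((x p.1 * v p.1) * ((y p.2.1 * v p.2.1) *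
      (z p.2.2 * v p.2.2))) = τ * (⟪v, x⟫ * ⟪v, y⟫ * ⟪v, z⟫) := by
    simp only [PiLp.inner_apply, RCLike.inner_apply, conj_trivial, Fintype.sum_prod_type,
      ← Finset.mul_sum, ← Finset.sum_mul]
    ring
  rw [← h1, tri, tri, ← Finset.sum_add_distrib]
  refine Finset.sum_congr rfl fun p _ => ?_
  rw [spiked]
  ring

/-- The trace matrix of a spiked tensor is a perturbation of a multiple of the projection onto the
spike. -/
theorem exists_traceMap_spiked (τ : ℝ) {v : EuclideanSpace ℝ (Fin n)} (hv : ‖v‖ = 1)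
    (A : Tensor n) {L : ℝ} (hL0 : 0 ≤ L) (hL : ∀ x y z, |tri A x y z| ≤ L * ‖x‖ * ‖y‖ * ‖z‖) :
    ∃ N : EuclideanSpace ℝ (Fin n) →L[ℝ] EuclideanSpace ℝ (Fin n),
      (∀ x, traceMap (spiked τ v A) x = ((τ ^ 2 + τ * ⟪v, traceVec A⟫) * ⟪v, x⟫) • v + N x) ∧
        ‖N‖ ≤ L * (|τ| + ‖traceVec A‖) := by
  set h := traceVec (spiked τ v A) with hh
  have hvh : τ * ⟪v, h⟫ = τ ^ 2 + τ * ⟪v, traceVec A⟫ := by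
    rw [hh, traceVec_spiked τ hv, inner_add_right, real_inner_smul_right, real_inner_self_eq_norm_sq,
      hv]
    ring
  have hnorm : ‖h‖ ≤ |τ| + ‖traceVec A‖ := by
    rw [hh, traceVec_spiked τ hv]
    refine (norm_add_le _ _).trans ?_
    rw [norm_smul, hv, mul_one, Real.norm_eq_abs]
  -- What remains is the contraction of `A` with `h`. Since `h` itself depends on `A`, a bound for
  -- fixed vectors would not do; `hL` is uniform in all three arguments.
  set N := traceMap (spiked τ v A) - (τ * ⟪v, h⟫) • (innerSL ℝ v).smulRight v with hN
  have hNx (x y) : ⟪y, N x⟫ = tri A h y x := by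
    simp only [hN, sub_apply, smul_apply, ContinuousLinearMap.smulRight_apply, innerSL_apply_apply,
      inner_sub_right, real_inner_smul_right, inner_traceMap, ← hh, tri_spiked, real_inner_comm v y]
    ring
  refine ⟨N, fun x => ?_, ?_⟩
  · rw [← hvh]
    simp [hN, smul_smul]
  · refine N.opNorm_le_bound (by positivity) fun x => ?_
    rcases (norm_nonneg (N x)).eq_or_lt with h0 | h0
    · rw [← h0]
      positivity
    · refine le_of_mul_le_mul_left ?_ h0
      calc ‖N x‖ * ‖N x‖ = tri A h (N x) x := by rw [← hNx, real_inner_self_eq_norm_sq, sq]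
        _ ≤ L * ‖h‖ * ‖N x‖ * ‖x‖ := (le_abs_self _).trans (hL _ _ _)
        _ ≤ L * (|τ| + ‖traceVec A‖) * ‖N x‖ * ‖x‖ := by gcongr
        _ = _ := by ring

/-- The coordinates are polynomials in the entries of `A`. This spares any discussion of the
measurability of eigenvectors. -/
theorem measurable_traceMap_iterate (τ : ℝ) (v x : EuclideanSpace ℝ (Fin n)) (t : ℕ) (j : Fin n) :
    Measurable fun A : Tensor n => ((traceMap (spiked τ v A))^[t] x) j := by
  induction t generalizing j with
  | zero =>
    simp only [Function.iterate_zero, id]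
    exact measurable_const
  | succ t ih =>
    simp only [Function.iterate_succ_apply', traceMap_apply]
    refine Finset.measurable_sum _ fun k _ => Measurable.mul ?_ (ih k)
    simp only [spiked]
    fun_prop

end Decomposition

/-! ### Numerical inequalities -/

section Numerics

/-- With `a = n ^ (1 / 4)`, `e = √ε` and `s = √(log n)`, the noise is smaller than the signal. -/
theorem noise_le_signal {a e s τ b γ : ℝ} (ha : 1 ≤ a) (he : 0 < e) (he1 : e ≤ 1) (hs : 1 ≤ s)
    (hτ : 1536 * a ^ 3 * (s / e) ≤ τ) (hb : b ≤ a ^ 4 * s) (hγ : |γ| ≤ a ^ 3) :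
    0 < τ ^ 2 + τ * γ ∧
      16 * (a ^ 2 * s) * (|τ| + b) ≤ (e / a + e ^ 2) / 48 * (τ ^ 2 + τ * γ) := by
  have hτe : 1536 * a ^ 3 * s ≤ τ * e := by
    rwa [← mul_div_assoc, div_le_iff₀ he] at hτ
  have ha3 : 1 ≤ a ^ 3 := one_le_pow₀ ha
  have hse : 1 ≤ s / e := by
    rw [le_div_iff₀ he]
    linarith
  have hτa : 2 * a ^ 3 ≤ τ := by nlinarith
  have hτ0 : 0 < τ := by linarith
  have hβ : τ ^ 2 / 2 ≤ τ ^ 2 + τ * γ := by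
    have := (abs_le.mp hγ).1
    nlinarith
  refine ⟨lt_of_lt_of_le (by positivity) hβ, ?_⟩
  -- The noise term with `τ` is charged to `e / a` and the term with `b` to `e ^ 2`. The constant is
  -- `1536 = 16 · 48 · 2`, with `16` from the injective norm and `2` from `β ≥ τ² / 2`.
  have h1 : 1536 * (a ^ 2 * s * τ) ≤ e / a * τ ^ 2 := by
    have : e / a * τ ^ 2 = τ * e * (τ / a) := by ring
    rw [this]
    calc 1536 * (a ^ 2 * s * τ) = 1536 * a ^ 3 * s * (τ / a) := by
          have : a ≠ 0 := by positivity
          field_simp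
      _ ≤ _ := by gcongr
  have h2 : 1536 * (a ^ 2 * s * (a ^ 4 * s)) ≤ e ^ 2 * τ ^ 2 := by
    calc 1536 * (a ^ 2 * s * (a ^ 4 * s)) ≤ 1536 * (1536 * (a ^ 2 * s * (a ^ 4 * s))) := by
          have : 0 < a ^ 2 * s * (a ^ 4 * s) := by positivity
          linarith
      _ = (1536 * a ^ 3 * s) ^ 2 := by ring
      _ ≤ (τ * e) ^ 2 := by gcongr
      _ = _ := by ring
  rw [abs_of_pos hτ0]
  calc 16 * (a ^ 2 * s) * (τ + b) ≤ 16 * (a ^ 2 * s) * (τ + a ^ 4 * s) := by gcongr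
    _ = (1536 * (a ^ 2 * s * τ) + 1536 * (a ^ 2 * s * (a ^ 4 * s))) / 96 := by ring
    _ ≤ (e / a * τ ^ 2 + e ^ 2 * τ ^ 2) / 96 := by gcongr
    _ = (e / a + e ^ 2) / 48 * (τ ^ 2 / 2) := by ring
    _ ≤ _ := by gcongr

/-- With `m` the minimum, `m e² ≤ 1` and `m / a² ≤ 1`; the mixed term `m e / a` is the geometric
mean of these two numbers. -/
theorem gap_mul_noise_le {a e : ℝ} (ha : 1 ≤ a) (he : 0 < e) :
    2 * min (1 / e ^ 2) (a ^ 2) * ((e / a + e ^ 2) / 8) ≤ 1 := by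
  set m := min (1 / e ^ 2) (a ^ 2)
  have hm0 : 0 ≤ m := le_min (by positivity) (by positivity)
  have h1 : m * e ^ 2 ≤ 1 := by
    rw [← le_div_iff₀ (by positivity)]
    exact min_le_left _ _
  have h2 : m * (e / a) ≤ 1 := by
    refine le_of_sq_le_sq ?_ zero_le_one
    calc (m * (e / a)) ^ 2 = m * e ^ 2 * (m / a ^ 2) := by ring
      _ ≤ 1 * 1 := by
        gcongr
        exact div_le_one_of_le₀ (min_le_right _ _) (by positivity)
      _ = 1 ^ 2 := by norm_num
  linarith

theorem mul_sq_le_four_pow {n : ℕ} (hn : 17 ≤ n) : 56 * (n : ℝ) ^ 2 ≤ 4 ^ n := by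
  induction n, hn using Nat.le_induction with
  | base => norm_num
  | succ n hn ih =>
    have : (17 : ℝ) ≤ n := by exact_mod_cast hn
    rw [pow_succ (4 : ℝ)]
    push_cast
    nlinarith

/-- This is why `n` iterations reach accuracy `ε = e²` for every `ε`: the factor `4^(-n)` beats the
polynomial loss, and `e^n ≤ e²`. -/
theorem pow_decay_of_size {n : ℕ} (hn : 17 ≤ n) {e ρ : ℝ} (he : 0 < e) (he1 : e ≤ 1) (hρ : 0 ≤ ρ)
    (hρe : ρ ≤ e / 4) : 56 * (n : ℝ) ^ 2 * ρ ^ n ≤ e ^ 2 := by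
  calc 56 * (n : ℝ) ^ 2 * ρ ^ n ≤ 4 ^ n * (e / 4) ^ n := by
        gcongr
        exact mul_sq_le_four_pow hn
    _ = e ^ n := by rw [← mul_pow]; congr 1; ring
    _ ≤ e ^ 2 := pow_le_pow_of_le_one he.le he1 (by omega)

/-- As `ρ ≤ 1/4 ≤ exp(-1)`, already `t ≥ 4 log(n / ε)` gives `ρ^t ≤ (ε / n)^4`, which outweighs `56
n²`. -/
theorem pow_decay_of_log {n : ℕ} (hn : 17 ≤ n) {ε ρ : ℝ} (hε : 0 < ε) (hε1 : ε < 1) (hρ : 0 ≤ ρ)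
    (hρ4 : ρ ≤ 1 / 4) {t : ℕ} (ht : (100 : ℕ) * Real.log (n / ε) ≤ t) :
    56 * (n : ℝ) ^ 2 * ρ ^ t ≤ ε := by
  have hn0 : (17 : ℝ) ≤ n := by exact_mod_cast hn
  have hlog : 0 ≤ Real.log (n / ε) := Real.log_nonneg (by rw [le_div_iff₀ hε]; linarith)
  have hρt : ρ ^ t ≤ (ε / n) ^ 4 := by
    calc ρ ^ t ≤ (Real.exp (-1)) ^ t := by
          gcongr
          rw [Real.exp_neg]
          refine hρ4.trans ?_
          rw [one_div]
          gcongr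
          linarith [Real.exp_one_lt_d9]
      _ = Real.exp (-t) := by rw [← Real.exp_nat_mul]; ring_nf
      _ ≤ Real.exp ((4 : ℕ) * -Real.log (n / ε)) := by
        gcongr
        push_cast at ht ⊢
        linarith
      _ = _ := by
        rw [Real.exp_nat_mul, Real.exp_neg, Real.exp_log (by positivity), inv_div]
  calc 56 * (n : ℝ) ^ 2 * ρ ^ t ≤ 56 * (n : ℝ) ^ 2 * (ε / n) ^ 4 := by gcongr
    _ = 56 / (n : ℝ) ^ 2 * ε ^ 3 * ε := by field_simp
    _ ≤ 1 * 1 * ε := by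
      gcongr
      · rw [div_le_one (by positivity)]
        nlinarith
      · exact pow_le_one₀ hε.le hε1.le
    _ = ε := by ring

end Numerics

/-! ### Recovery from deterministic bounds -/

section Main

open scoped RealInnerProductSpace

variable {n : ℕ}

/-- The conclusions about the trace matrix and the program, from deterministic bounds on the
Gaussian input. -/
theorem recovery_of_bounds (hn : 17 ≤ n) {v : EuclideanSpace ℝ (Fin n)} (hv : ‖v‖ = 1) {ε τ : ℝ}
    (hε : 0 < ε) (hε1 : ε < 1)
    (hτ : 1536 * (n : ℝ) ^ (3 / 4 : ℝ) * Real.sqrt (Real.log n / ε) ≤ τ) {A : Tensor n}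
    {g : Fin n → ℝ}
    (hA : ∀ x y z, |tri A x y z| ≤ 16 * √(n * Real.log n) * ‖x‖ * ‖y‖ * ‖z‖)
    (htr : ‖traceVec A‖ ^ 2 ≤ n ^ 2 * Real.log n)
    (hvt : ⟪v, traceVec A⟫ ^ 2 ≤ n * √n)
    (hg : ‖(WithLp.toLp 2 g : EuclideanSpace ℝ (Fin n))‖ ^ 2 ≤ n ^ 2)
    (hq : 1 / n * ‖(traceMap (spiked τ v A)).adjoint^[n] v‖ ≤
      |⟪(traceMap (spiked τ v A)).adjoint^[n] v, WithLp.toLp 2 g⟫|) :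
    ∃ (lam : ℝ) (u : EuclideanSpace ℝ (Fin n)),
      IsTopEigenvector (traceMatrix (spiked τ v A)) lam u ∧
      SpectralGapRatioGE (traceMatrix (spiked τ v A)) lam (2 * min (1 / ε) (Real.sqrt n)) ∧
      (∀ t : ℕ, (100 : ℕ) * Real.log (n / ε) ≤ t →
        signDist (powerIterate (traceMatrix (spiked τ v A)) (WithLp.toLp 2 g) t) u ≤ ε) ∧
      ‖RealRAM.tracePower.output n (stream (spiked τ v A)) (List.ofFn g) (100 * n ^ 3)‖ = 1 ∧
      signDist (RealRAM.tracePower.output n (stream (spiked τ v A)) (List.ofFn g) (100 * n ^ 3)) u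
        ≤ ε := by
  have hn17 : (17 : ℝ) ≤ n := by exact_mod_cast hn
  have hn0 : (0 : ℝ) < n := by linarith
  set x : EuclideanSpace ℝ (Fin n) := WithLp.toLp 2 g
  set F := traceMap (spiked τ v A)
  have hF (y) : F y = (traceMatrix (spiked τ v A)).toEuclideanLin y := rfl
  -- In terms of `a`, `e = √ε` and `s = √(log n)` all bounds become polynomial.
  set a := (n : ℝ) ^ (1 / 4 : ℝ) with ha
  have ha1 : 1 ≤ a := Real.one_le_rpow (by linarith) (by norm_num)
  have ha4 : a ^ 4 = n := by
    rw [ha, ← Real.rpow_natCast, ← Real.rpow_mul hn0.le]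
    norm_num
  have ha3 : a ^ 3 = (n : ℝ) ^ (3 / 4 : ℝ) := by
    rw [ha, ← Real.rpow_natCast, ← Real.rpow_mul hn0.le]
    norm_num
  have ha2 : √n = a ^ 2 := by
    rw [← ha4, Real.sqrt_eq_iff_mul_self_eq (by positivity) (by positivity)]
    ring
  set e := √ε with he
  have he0 : 0 < e := Real.sqrt_pos.mpr hε
  have he2 : e ^ 2 = ε := Real.sq_sqrt hε.le
  have he1 : e ≤ 1 := Real.sqrt_le_one.mpr hε1.le
  set s := √(Real.log n) with hs
  have hlog1 : 1 ≤ Real.log n := by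
    rw [Real.le_log_iff_exp_le hn0]
    linarith [Real.exp_one_lt_d9]
  have hs1 : 1 ≤ s := Real.one_le_sqrt.mpr hlog1
  have hs2 : s ^ 2 = Real.log n := Real.sq_sqrt (by linarith)
  rw [Real.sqrt_div' _ hε.le, ← ha3] at hτ
  rw [Real.sqrt_mul hn0.le, ha2] at hA
  obtain ⟨N, hFN, hN⟩ := exists_traceMap_spiked τ hv A (by positivity) hA
  have htr' : ‖traceVec A‖ ≤ a ^ 4 * s := by
    refine le_of_sq_le_sq ?_ (by positivity)
    rwa [mul_pow, hs2, ha4]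
  have hvt' : |⟪v, traceVec A⟫| ≤ a ^ 3 := by
    refine abs_le_of_sq_le_sq ?_ (by positivity)
    rw [ha2, ← ha4] at hvt
    linarith
  obtain ⟨hβ, hnoise⟩ := noise_le_signal ha1 he0 he1 hs1 hτ htr' hvt'
  have hea : e / a ≤ e := div_le_self he0.le ha1
  have hee : e ^ 2 ≤ e := by nlinarith
  -- Here `η = (e / a + e ^ 2) / 48 ≤ 1/24`.
  obtain ⟨lam, hlam, u, l, hD⟩ := exists_dominant hv hβ hFN (hN.trans hnoise) (by linarith)
  have hlam0 : 0 < lam := lt_of_lt_of_le (mul_pos hβ (by linarith)) hlam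
  set ρ := 6 * ((e / a + e ^ 2) / 48) with hρ
  have hρ0 : 0 ≤ ρ := by positivity
  have hρe : ρ ≤ e / 4 := by linarith
  have hdecay := pow_decay_of_size hn he0 he1 hρ0 hρe
  have hx : ‖x‖ ≤ n := le_of_sq_le_sq hg hn0.le
  have hα0 : (0 : ℝ) < 1 / (4 * n) := by positivity
  have hsmall : ρ ^ n * (7 * ‖x‖) < 1 / (4 * n) := by
    rw [lt_div_iff₀ (by positivity)]
    calc ρ ^ n * (7 * ‖x‖) * (4 * n) ≤ ρ ^ n * (7 * n) * (4 * n) := by gcongr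
      _ = 56 * n ^ 2 * ρ ^ n / 2 := by ring
      _ < 1 := by linarith
  -- Of the main term `1 / (2 n)` at most half, `1 / (4 n)`, is lost to the decayed remainder.
  have hcoeff : 1 / (4 * n) ≤ |⟪l, x⟫ / ⟪l, u⟫| := by
    refine le_trans ?_ (hD.le_abs_coeff hlam0 hρ0 hv (by positivity) n hq)
    have : (1 / n : ℝ) / 2 = 2 * (1 / (4 * n)) := by field_simp; norm_num
    linarith
  have hdist (t : ℕ) : signDist (‖F^[t] x‖⁻¹ • F^[t] x) (‖u‖⁻¹ • u) ≤ 56 * n ^ 2 * ρ ^ t := by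
    refine (hD.signDist_iterate_le hlam0 hρ0 hv hα0 hcoeff t).trans ?_
    calc 14 * ‖x‖ / (1 / (4 * n)) * ρ ^ t ≤ 14 * n / (1 / (4 * n)) * ρ ^ t := by gcongr
      _ = _ := by field_simp; ring
  have hout := tracePower_output (by omega) (spiked τ v A) g (le_refl 100)
  refine ⟨lam, ‖u‖⁻¹ • u, hD.isTopEigenvector hv hlam0 hρ0 (by linarith) hF,
    hD.spectralGapRatioGE hv hlam0 hρ0 (by linarith) hF (by positivity) ?_, fun t ht => ?_, ?_, ?_⟩
  · rw [← he2, ha2, show ρ = (e / a + e ^ 2) / 8 by rw [hρ]; ring]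
    exact gap_mul_noise_le ha1 he0
  · rw [powerIterate_eq]
    exact (hdist t).trans (pow_decay_of_log hn hε hε1 hρ0 (by linarith) ht)
  · rw [hout, norm_smul, norm_inv, norm_norm, inv_mul_cancel₀]
    exact norm_ne_zero_iff.mpr (hD.iterate_ne_zero hlam0 hρ0 hv hcoeff n hsmall)
  · rw [hout, ← he2]
    exact (hdist n).trans hdecay

end Main

/-! ### Probabilities of the bad events -/

section Events

open scoped RealInnerProductSpace

variable {n : ℕ}

/-- The trace vector has `n` coordinates of variance `n`, so its expected squared norm is `n²`. -/
theorem stdGaussianPi_traceVec_le (hn : 17 ≤ n) :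
    stdGaussianPi (Fin n × Fin n × Fin n) {A | n ^ 2 * Real.log n ≤ ‖traceVec A‖ ^ 2} ≤
      ENNReal.ofReal (1 / Real.log n) := by
  have hn0 : (1 : ℝ) < n := by exact_mod_cast (by omega : 1 < n)
  have hlog : 0 < Real.log n := Real.log_pos hn0
  refine (measure_mono fun A hA => ?_).trans ((stdGaussianPi_le_sum_sq_le
    (fun (i : Fin n) (p : Fin n × Fin n × Fin n) => if p.1 = i ∧ p.2.1 = p.2.2 then 1 else 0)
    (c := n ^ 2 * Real.log n) (by positivity)).trans (ENNReal.ofReal_le_ofReal (le_of_eq ?_)))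
  · rw [Set.mem_ofPred_eq] at hA ⊢
    rw [EuclideanSpace.real_norm_sq_eq] at hA
    simpa [traceVec, Fintype.sum_prod_type, ite_and] using hA
  · have hdiag : ({x | x.1 = x.2} : Finset (Fin n × Fin n)) = Finset.univ.diag := by
      ext
      simp
    simp [Fintype.sum_prod_type, ite_and, hdiag]
    field_simp

/-- The component along a unit vector has variance `n` only, smaller by a factor `n` than the second
moment of the whole norm. -/
theorem stdGaussianPi_inner_traceVec_le (hn : 17 ≤ n) {v : EuclideanSpace ℝ (Fin n)}
    (hv : ‖v‖ = 1) :
    stdGaussianPi (Fin n × Fin n × Fin n) {A | n * √n ≤ ⟪v, traceVec A⟫ ^ 2} ≤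
      ENNReal.ofReal (1 / √n) := by
  have hn0 : (0 : ℝ) < n := by exact_mod_cast (by omega : 0 < n)
  have h1 : ∑ a, v a ^ 2 = 1 := by rw [← EuclideanSpace.real_norm_sq_eq, hv, one_pow]
  refine (measure_mono fun A hA => ?_).trans ((stdGaussianPi_le_sum_sq_le
    (fun (_ : Unit) (p : Fin n × Fin n × Fin n) => if p.2.1 = p.2.2 then v p.1 else 0)
    (c := n * √n) (by positivity)).trans (ENNReal.ofReal_le_ofReal (le_of_eq ?_)))
  · rw [Set.mem_ofPred_eq] at hA ⊢
    refine hA.trans (le_of_eq ?_)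
    simp [traceVec, Fintype.sum_prod_type, PiLp.inner_apply, Finset.mul_sum, mul_comm]
  · simp [Fintype.sum_prod_type, ite_pow, ← Finset.mul_sum, h1]
    field_simp

theorem stdGaussianPi_norm_le (hn : 17 ≤ n) :
    stdGaussianPi (Fin n) {g | n ^ 2 ≤ ‖(WithLp.toLp 2 g : EuclideanSpace ℝ (Fin n))‖ ^ 2} ≤
      ENNReal.ofReal (1 / n) := by
  have hn0 : (0 : ℝ) < n := by exact_mod_cast (by omega : 0 < n)
  refine (measure_mono fun g hg => ?_).trans ((stdGaussianPi_le_sum_sq_le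
    (fun (i j : Fin n) => if i = j then 1 else 0)
    (c := n ^ 2) (by positivity)).trans (ENNReal.ofReal_le_ofReal (le_of_eq ?_)))
  · rw [Set.mem_ofPred_eq] at hg ⊢
    simpa [EuclideanSpace.real_norm_sq_eq] using hg
  · simp
    field_simp

/-- The vector `(F*)^n v` stands in for the left eigenvector: it is a measurable function of `A`
alone, hence independent of `g`. -/
theorem prod_adjoint_iterate_inner_lt_le (τ : ℝ) (v : EuclideanSpace ℝ (Fin n)) :
    ((stdGaussianPi (Fin n × Fin n × Fin n)).prod (stdGaussianPi (Fin n)))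
      {ω | |⟪(traceMap (spiked τ v ω.1)).adjoint^[n] v, WithLp.toLp 2 ω.2⟫| <
        1 / n * ‖(traceMap (spiked τ v ω.1)).adjoint^[n] v‖} ≤ ENNReal.ofReal (1 / n) := by
  have hq : Measurable fun (A : Tensor n) (i : Fin n) =>
      ((traceMap (spiked τ v A)).adjoint^[n] v) i := by
    refine measurable_pi_lambda _ fun i => ?_
    have h1 (A : Tensor n) : ((traceMap (spiked τ v A)).adjoint^[n] v) i =
        ∑ j, v j * ((traceMap (spiked τ v A))^[n] (EuclideanSpace.single i 1)) j := by
      have := inner_adjoint_iterate (traceMap (spiked τ v A)) n v (EuclideanSpace.single i 1)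
      rw [EuclideanSpace.inner_single_right] at this
      simpa [PiLp.inner_apply, mul_comm] using this
    simp_rw [h1]
    exact Finset.measurable_sum _ fun j _ => (measurable_traceMap_iterate τ v _ n j).const_mul _
  refine (measure_mono fun ω hω => ?_).trans (prod_stdGaussianPi_abs_sum_mul_lt_le _ hq (1 / n))
  rw [Set.mem_ofPred_eq] at hω ⊢
  rw [EuclideanSpace.norm_eq] at hω
  simpa [PiLp.inner_apply, mul_comm] using hω

/-- No measurability of `s` is required, so the events defined by quantifiers over vectors need no
separate treatment. -/
theorem prod_fst_mem {Ω Ω' : Type*} [MeasurableSpace Ω] [MeasurableSpace Ω'] {μ : Measure Ω}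
    {ν : Measure Ω'} [IsProbabilityMeasure ν] (s : Set Ω) :
    μ.prod ν {ω | ω.1 ∈ s} = μ s := by
  rw [show {ω : Ω × Ω' | ω.1 ∈ s} = s ×ˢ Set.univ by ext; simp, Measure.prod_prod, measure_univ,
    mul_one]

theorem prod_snd_mem {Ω Ω' : Type*} [MeasurableSpace Ω] [MeasurableSpace Ω'] {μ : Measure Ω}
    {ν : Measure Ω'} [SFinite ν] [IsProbabilityMeasure μ] (s : Set Ω') :
    μ.prod ν {ω | ω.2 ∈ s} = ν s := by
  rw [show {ω : Ω × Ω' | ω.2 ∈ s} = Set.univ ×ˢ s by ext; simp, Measure.prod_prod, measure_univ,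
    one_mul]

/-- A bound on the failure probability. -/
noncomputable def failureBound (n : ℕ) : ℝ :=
  if n < 17 then 1 else 1 / n + 1 / Real.log n + 1 / √n + 1 / n + 1 / n

theorem tendsto_failureBound : Tendsto failureBound atTop (𝓝 0) := by
  have h1 : Tendsto (fun n : ℕ => 1 / (n : ℝ)) atTop (𝓝 0) := tendsto_one_div_atTop_nhds_zero_nat
  have h2 : Tendsto (fun n : ℕ => 1 / Real.log n) atTop (𝓝 0) := by
    simp_rw [one_div]
    exact (Real.tendsto_log_atTop.comp tendsto_natCast_atTop_atTop).inv_tendsto_atTop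
  have h3 : Tendsto (fun n : ℕ => 1 / √(n : ℝ)) atTop (𝓝 0) := by
    simp_rw [one_div]
    exact (Real.tendsto_sqrt_atTop.comp tendsto_natCast_atTop_atTop).inv_tendsto_atTop
  have h := (((h1.add h2).add h3).add h1).add h1
  simp only [add_zero] at h
  refine h.congr' ?_
  filter_upwards [eventually_ge_atTop 17] with n hn
  rw [failureBound, if_neg (by omega)]

end Events

end TensorPCA

/-! ### The main theorem by a union bound -/

theorem mainTheorem10 :
    ∃ (P : RealRAM.Program) (K : ℕ) (C : ℝ) (δ : ℕ → ℝ), 0 < C ∧ Tendsto δ atTop (𝓝 0) ∧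
      -- linear time, quadratic working space, one pass, on every input
      (∀ (n : ℕ), 0 < n → ∀ (T : TensorPCA.Tensor n) (g : Fin n → ℝ),
        P.RunsWithin n (TensorPCA.stream T) (List.ofFn g) (K * n ^ 3) (K * n ^ 2)) ∧
      -- correctness in the spiked tensor model, with high probability
      (∀ (n : ℕ), 0 < n → ∀ (v : EuclideanSpace ℝ (Fin n)), ‖v‖ = 1 →
        ∀ (ε : ℝ), 0 < ε → ε < 1 →
        ∀ (τ : ℝ), C * (n : ℝ) ^ (3 / 4 : ℝ) * Real.sqrt (Real.log n / ε) ≤ τ →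
        ((TensorPCA.stdGaussianPi (Fin n × Fin n × Fin n)).prod
            (TensorPCA.stdGaussianPi (Fin n)))
          {ω | ¬ ∃ (lam : ℝ) (u : EuclideanSpace ℝ (Fin n)),
            TensorPCA.IsTopEigenvector
              (TensorPCA.traceMatrix (TensorPCA.spiked τ v ω.1)) lam u ∧
            TensorPCA.SpectralGapRatioGE
              (TensorPCA.traceMatrix (TensorPCA.spiked τ v ω.1)) lam
              (2 * min (1 / ε) (Real.sqrt n)) ∧
            (∀ t : ℕ, K * Real.log (n / ε) ≤ t →
              TensorPCA.signDist
                (TensorPCA.powerIterate (TensorPCA.traceMatrix (TensorPCA.spiked τ v ω.1))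
                  (WithLp.toLp 2 ω.2) t) u ≤ ε) ∧
            ‖P.output n (TensorPCA.stream (TensorPCA.spiked τ v ω.1)) (List.ofFn ω.2)
                (K * n ^ 3)‖ = 1 ∧
            TensorPCA.signDist
              (P.output n (TensorPCA.stream (TensorPCA.spiked τ v ω.1)) (List.ofFn ω.2)
                (K * n ^ 3)) u ≤ ε}
          ≤ ENNReal.ofReal (δ n)) := by
  refine ⟨RealRAM.tracePower, 100, 1536, TensorPCA.failureBound, by norm_num, TensorPCA.tendsto_failureBound,
    fun n hn T g => (RealRAM.tracePower_runsWithin hn _ _ le_rfl).1,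
    fun n _ v hv ε hε hε1 τ hτ => ?_⟩
  -- For small `n` the failure bound is `1` and there is nothing to prove.
  by_cases hn : n < 17
  · rw [TensorPCA.failureBound, if_pos hn, ENNReal.ofReal_one]
    exact prob_le_one
  rw [TensorPCA.failureBound, if_neg hn]
  rw [not_lt] at hn
  have hlog : 0 ≤ Real.log n := Real.log_natCast_nonneg n
  rw [ENNReal.ofReal_add (by positivity) (by positivity),
    ENNReal.ofReal_add (by positivity) (by positivity),
    ENNReal.ofReal_add (by positivity) (by positivity),
    ENNReal.ofReal_add (by positivity) (by positivity)]
  -- Five bad events: large injective norm, large trace vector, large component of it along `v`,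
  -- large `g`, and `g` almost orthogonal to the iterated adjoint.
  refine le_trans (measure_mono (t := ((({ω | ω.1 ∈ {A : TensorPCA.Tensor n | ∃ x y z,
    16 * √(n * Real.log n) * ‖x‖ * ‖y‖ * ‖z‖ < |TensorPCA.tri A x y z|}} ∪
    {ω | ω.1 ∈ {A : TensorPCA.Tensor n | n ^ 2 * Real.log n ≤ ‖TensorPCA.traceVec A‖ ^ 2}}) ∪
    {ω | ω.1 ∈ {A : TensorPCA.Tensor n | n * √n ≤ inner ℝ v (TensorPCA.traceVec A) ^ 2}}) ∪
    {ω | ω.2 ∈ {g : Fin n → ℝ | n ^ 2 ≤ ‖(WithLp.toLp 2 g : EuclideanSpace ℝ (Fin n))‖ ^ 2}}) ∪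
    {ω | |inner ℝ ((TensorPCA.traceMap (TensorPCA.spiked τ v ω.1)).adjoint^[n] v) (WithLp.toLp 2 ω.2)| <
        1 / n * ‖(TensorPCA.traceMap (TensorPCA.spiked τ v ω.1)).adjoint^[n] v‖}) fun ω hω => ?_) ?_
  · by_contra hcon
    simp only [Set.mem_union, Set.mem_ofPred_eq, not_or, not_exists, not_lt, not_le] at hcon
    obtain ⟨⟨⟨⟨h1, h2⟩, h3⟩, h4⟩, h5⟩ := hcon
    exact hω (TensorPCA.recovery_of_bounds hn hv hε hε1 hτ h1 h2.le h3.le h4.le h5)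
  · refine (measure_union_le _ _).trans (add_le_add ((measure_union_le _ _).trans (add_le_add
      ((measure_union_le _ _).trans (add_le_add ((measure_union_le _ _).trans (add_le_add
        ?_ ?_)) ?_)) ?_)) ?_)
    · rw [TensorPCA.prod_fst_mem]
      exact TensorPCA.stdGaussianPi_exists_tri_gt_le hn
    · rw [TensorPCA.prod_fst_mem]
      exact TensorPCA.stdGaussianPi_traceVec_le hn
    · rw [TensorPCA.prod_fst_mem]
      exact TensorPCA.stdGaussianPi_inner_traceVec_le hn hv
    · rw [TensorPCA.prod_snd_mem]
      exact TensorPCA.stdGaussianPi_norm_le hn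
    · exact TensorPCA.prod_adjoint_iterate_inner_lt_le τ v
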